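/- Let $R$ be a commutative ring which is complete with respect to a nonarchimedean absolute value $|\cdot|$. For $n\ge 0$ let $R\langle t_1,\dots,t_n\rangle^\dagger$ be the ring of overconvergent power series over $R$, i.e. the ring of those formal power series $\sum_I c_I t^I\in R[[t_1,\dots,t_n]]$ for which there are real numbers $\rho_1,\dots,\rho_n>1$ such that $|c_I|\rho_1^{i_1}\cdots\rho_n^{i_n}\to 0$ as $i_1+\cdots+i_n\to\infty$, where $I=(i_1,\dots,i_n)$ runs over the $n$-tuples of nonnegative integers. (a) Let $K$ be a field which is complete with respect to a nontrivial nonarchimedean absolute value (for instance the fraction field of a complete discrete valuation ring). Then, for every $n\ge 0$, every finitely generated projective module over $K\langle t_1,\dots,t_n\rangle^\dagger$ is free. (b) Let $\mathcal O$ be a complete discrete valuation ring with valuation $v$, equipped with an absolute value $|x|=c^{v(x)}$, where $0<c<1$ (the ring $\mathcal O\langle t_1,\dots,t_n\rangle^\dagger$ does not depend on $c$). Then, for every $n\ge 0$, every finitely generated projective module over $\mathcal O\langle t_1,\dots,t_n\rangle^\dagger$ is free. -/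

import Mathlib

namespace MvPowerSeries

variable {R : Type*} [NormedCommRing R] {n : ℕ}

theorem IsRestricted.mono_radius {ρ ρ' : Fin n → ℝ} (h0 : ∀ i, 0 ≤ ρ' i) (h : ∀ i, ρ' i ≤ ρ i)
    {f : MvPowerSeries (Fin n) R} (hf : IsRestricted ρ f) : IsRestricted ρ' f := by
  unfold IsRestricted at *
  refine squeeze_zero (fun t => ?_) (fun t => ?_) hf
  · exact mul_nonneg (norm_nonneg _) (Finset.prod_nonneg fun i _ => pow_nonneg (h0 i) _)
  · refine mul_le_mul_of_nonneg_left ?_ (norm_nonneg _)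
    exact Finset.prod_le_prod (fun i _ => pow_nonneg (h0 i) _)
      fun i _ => pow_le_pow_left₀ (h0 i) (h i) _

/-- A power series `f = ∑ c_I t^I` in `n` variables over a normed ring is *overconvergent* if it
converges on a closed polydisc with all radii `ρ i > 1`, that is, `‖c_I‖ * ρ ^ I → 0`. -/
def IsOverconvergent (f : MvPowerSeries (Fin n) R) : Prop :=
  ∃ ρ : Fin n → ℝ, (∀ i, 1 < ρ i) ∧ IsRestricted ρ f

theorem IsOverconvergent.common {f g : MvPowerSeries (Fin n) R}
    (hf : IsOverconvergent f) (hg : IsOverconvergent g) :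
    ∃ ρ : Fin n → ℝ, (∀ i, 1 < ρ i) ∧ IsRestricted ρ f ∧ IsRestricted ρ g := by
  obtain ⟨ρ, hρ, hf⟩ := hf
  obtain ⟨τ, hτ, hg⟩ := hg
  have h1 : ∀ i, 1 < min (ρ i) (τ i) := fun i => lt_min (hρ i) (hτ i)
  have h0 : ∀ i, 0 ≤ min (ρ i) (τ i) := fun i => zero_le_one.trans (h1 i).le
  exact ⟨fun i => min (ρ i) (τ i), h1, hf.mono_radius h0 fun i => min_le_left _ _,
    hg.mono_radius h0 fun i => min_le_right _ _⟩

/-- The ring `R⟨t_1, …, t_n⟩^†` of overconvergent power series in `n` variables over an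
ultrametric normed commutative ring `R`: the union over all radii `ρ` with every `ρ i > 1` of the
rings of power series converging on the closed polydisc of radius `ρ`. -/
def overconvergent (n : ℕ) (R : Type*) [NormedCommRing R] [IsUltrametricDist R] : Subring (MvPowerSeries (Fin n) R) where
  carrier := {f | IsOverconvergent f}
  zero_mem' := ⟨fun _ => 2, fun _ => one_lt_two, isRestricted_zero _⟩
  one_mem' := ⟨fun _ => 2, fun _ => one_lt_two, isRestricted_one _⟩
  neg_mem' := fun ⟨ρ, hρ, hf⟩ => ⟨ρ, hρ, isRestricted.neg ρ hf⟩
  add_mem' := fun hf hg =>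
    let ⟨ρ, hρ, hf, hg⟩ := hf.common hg
    ⟨ρ, hρ, isRestricted.add ρ hf hg⟩
  mul_mem' := fun hf hg =>
    let ⟨ρ, hρ, hf, hg⟩ := hf.common hg
    ⟨ρ, hρ, isRestricted.mul ρ hf hg⟩

end MvPowerSeries

-- Part (a) is an induction on `n` in the style of Quillen and Suslin, with Weierstrass preparation
-- in place of the normalisation of polynomials. Write `A` and `B` for the rings in `n` and `n + 1`
-- variables. After a shear of the variables and multiplication by a unit, any nonzero `g : B`
-- becomes a monic polynomial `w` over `A` with `A[X]/w = B/w` (`weierstrassOver_overconvergent`).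
-- Everything else on this side is algebra based on that property
-- (`WeierstrassOver.projectiveFree`).
--
-- Projective modules over `B` are stably free: embed `P` in `B ^ r` with cokernel `M` killed by
-- some `w`. Since `B/w` is finite free over `A`, the module `M` is finite projective over `A`,
-- hence free by induction. If `T` is the matrix of multiplication by `t` on `M`, then `t - T`
-- resolves `M` by free `B`-modules of equal rank, and Schanuel's lemma compares this resolution
-- with `P → B ^ r → M`.
--
-- Stably free modules over `B` are free, because unimodular vectors over `B` can be moved to a
-- basis vector: make one entry a monic `w`, reduce the other entries modulo `w` to polynomials, and
-- obtain a unimodular vector over `A[X]` with a monic entry. Horrocks' theorem at each localization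
-- and Quillen's patching identify it with its value at `X = 0`, a vector over `A`, where the
-- induction hypothesis applies.
--
-- Weierstrass division is a fixed point problem for a contraction in a Gauss norm
-- (`GaussLE.exists_eq_add`). A shear whose weights separate the finitely many dominant monomials
-- makes a single power of `X₀` dominate (`isDistinguished_shear`).
--
-- For (b), let `p` be a uniformizer. It lies in the Jacobson radical, so freeness can be tested
-- modulo `p`. The quotient is the ring of overconvergent series over the residue field with trivial
-- absolute value, that is, a polynomial ring. The induction for (a) never uses nontriviality of the
-- absolute value, so it covers this quotient as well.

universe u

/-! ### Unimodular vectors under invertible matrices. -/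

section Algebra

open Polynomial Matrix

/-- Two column vectors are equivalent if an invertible matrix takes one to the other. -/
def RowEquiv {S : Type*} [CommRing S] {n : ℕ} (v w : Fin n → S) : Prop :=
  ∃ g h : Matrix (Fin n) (Fin n) S, g * h = 1 ∧ h * g = 1 ∧ g *ᵥ v = w

/-- The entries of the vector generate the unit ideal. -/
def IsUnimodularVec {S : Type*} [CommRing S] {n : ℕ} (v : Fin n → S) : Prop :=
  ∃ u : Fin n → S, u ⬝ᵥ v = 1

namespace RowEquiv

variable {S S' : Type*} [CommRing S] [CommRing S'] {n : ℕ} {u v w : Fin n → S}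

theorem refl (v : Fin n → S) : RowEquiv v v := ⟨1, 1, by simp, by simp, by simp⟩

theorem symm (h : RowEquiv v w) : RowEquiv w v := by
  obtain ⟨g, h, h1, h2, rfl⟩ := h
  exact ⟨h, g, h2, h1, by rw [mulVec_mulVec, h2, one_mulVec]⟩

theorem trans (h : RowEquiv u v) (h' : RowEquiv v w) : RowEquiv u w := by
  obtain ⟨g, h, h1, h2, rfl⟩ := h
  obtain ⟨g', h', h1', h2', rfl⟩ := h'
  refine ⟨g' * g, h * h', ?_, ?_, by rw [mulVec_mulVec]⟩
  · rw [Matrix.mul_assoc, ← Matrix.mul_assoc g, h1, Matrix.one_mul, h1']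
  · rw [Matrix.mul_assoc, ← Matrix.mul_assoc h', h2', Matrix.one_mul, h2]

theorem map (h : RowEquiv v w) (f : S →+* S') : RowEquiv (f ∘ v) (f ∘ w) := by
  obtain ⟨g, h, h1, h2, rfl⟩ := h
  refine ⟨g.map f, h.map f, ?_, ?_, ?_⟩
  · rw [← Matrix.map_mul, h1, Matrix.map_one f (map_zero f) (map_one f)]
  · rw [← Matrix.map_mul, h2, Matrix.map_one f (map_zero f) (map_one f)]
  · ext i; simp [RingHom.map_mulVec]

theorem of_det (g : Matrix (Fin n) (Fin n) S) (hg : IsUnit g.det) (v : Fin n → S) :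
    RowEquiv v (g *ᵥ v) :=
  ⟨g, g⁻¹, g.mul_nonsing_inv hg, g.nonsing_inv_mul hg, rfl⟩

theorem isUnimodularVec (h : RowEquiv v w) (hv : IsUnimodularVec v) : IsUnimodularVec w := by
  obtain ⟨g, h, h1, h2, rfl⟩ := h
  obtain ⟨u, hu⟩ := hv
  exact ⟨u ᵥ* h, by rw [← dotProduct_mulVec, mulVec_mulVec, h2, one_mulVec, hu]⟩

/-- Multiples of one entry may be added to the other entries. -/
theorem add_mul (v : Fin n → S) (i : Fin n) (c : Fin n → S) (hc : c i = 0) :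
    RowEquiv v (fun j => v j + c j * v i) := by
  have key : ∀ c : Fin n → S, c i = 0 → ∀ v : Fin n → S,
      (1 + vecMulVec c (Pi.single i 1)) *ᵥ v = fun j => v j + c j * v i := by
    intro c _ v
    ext j
    simp [add_mulVec, vecMulVec_mulVec, mul_comm]
  -- The rank one matrix `c eᵢᵀ` has square `cᵢ c eᵢᵀ = 0`, so changing the sign of `c` inverts the
  -- transvection.
  have inv : ∀ c : Fin n → S, c i = 0 →
      (1 + vecMulVec c (Pi.single i 1)) * (1 + vecMulVec (-c) (Pi.single i 1)) = 1 := by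
    intro c hc
    rw [Matrix.add_mul, Matrix.mul_add, Matrix.mul_add, vecMulVec_mul_vecMulVec]
    simp [hc]
  refine ⟨_, _, inv c hc, ?_, key c hc v⟩
  simpa using inv (-c) (by simp [hc])

theorem update_add (v : Fin n → S) {k : Fin n} {x : S} (c : Fin n → S) (hc : c k = 0)
    (hx : x = c ⬝ᵥ v) : RowEquiv v (Function.update v k (v k + x)) := by
  have key : ∀ c : Fin n → S, ∀ v : Fin n → S,
      (1 + vecMulVec (Pi.single k 1) c) *ᵥ v = Function.update v k (v k + c ⬝ᵥ v) := by
    intro c v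
    ext j
    rcases eq_or_ne j k with rfl | h
    · simp [add_mulVec, vecMulVec_mulVec]
    · simp [add_mulVec, vecMulVec_mulVec, h]
  have inv : ∀ c : Fin n → S, c k = 0 →
      (1 + vecMulVec (Pi.single k 1) c) * (1 + vecMulVec (Pi.single k 1) (-c)) = 1 := by
    intro c hc
    rw [Matrix.add_mul, Matrix.mul_add, Matrix.mul_add, vecMulVec_mul_vecMulVec]
    simp [hc]
  refine ⟨_, _, inv c hc, ?_, hx ▸ key c v⟩
  simpa using inv (-c) (by simp [hc])

/-- A vector with an entry equal to one is equivalent to a standard basis vector. -/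
theorem single_of_eq_one (v : Fin n → S) (i : Fin n) (h : v i = 1) :
    RowEquiv v (Pi.single i 1) := by
  classical
  convert add_mul v i (fun j => if j = i then 0 else - v j) (by simp) using 1
  ext j
  rcases eq_or_ne j i with rfl | hj
  · simp [h]
  · simp [h, hj]

theorem smul_unit (v : Fin n → S) (c : Sˣ) : RowEquiv v (fun j => c * v j) := by
  refine ⟨(c : S) • 1, ((c⁻¹ : Sˣ) : S) • 1, ?_, ?_, ?_⟩
  · simp [smul_smul]
  · simp [smul_smul]
  · ext j; simp [smul_mulVec]

end RowEquiv

namespace IsUnimodularVec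

variable {S S' : Type*} [CommRing S] [CommRing S'] {n : ℕ}

theorem map {v : Fin n → S} (h : IsUnimodularVec v) (f : S →+* S') :
    IsUnimodularVec (f ∘ v) := by
  obtain ⟨u, hu⟩ := h
  refine ⟨f ∘ u, ?_⟩
  rw [← map_one f, ← hu, RingHom.map_dotProduct]

/-- In length two, the relation `u ⬝ᵥ v = 1` is itself a determinant: that of the matrix with rows
`u` and `(-v 1, v 0)`. -/
theorem rowEquiv_single_two {v : Fin 2 → S} (h : IsUnimodularVec v) :
    RowEquiv v (Pi.single 0 1) := by
  obtain ⟨u, hu⟩ := h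
  simp only [dotProduct, Fin.sum_univ_two] at hu
  convert RowEquiv.of_det !![u 0, u 1; - v 1, v 0] ?_ v using 1
  · ext j
    fin_cases j
    · simp [Matrix.mulVec, dotProduct, hu]
    · simp [Matrix.mulVec, dotProduct]; ring
  · simp only [Matrix.det_fin_two_of]
    rw [show u 0 * v 0 - u 1 * -v 1 = 1 by rw [← hu]; ring]
    exact isUnit_one

theorem rowEquiv_single_one {v : Fin 1 → S} (h : IsUnimodularVec v) :
    RowEquiv v (Pi.single 0 1) := by
  obtain ⟨u, hu⟩ := h
  simp only [dotProduct, Fin.sum_univ_one] at hu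
  convert RowEquiv.of_det !![u 0] ?_ v using 1
  · ext j
    fin_cases j
    simp [Matrix.mulVec, dotProduct, hu]
  · simpa using IsUnit.of_mul_eq_one _ hu

end IsUnimodularVec

/-! ### Horrocks' theorem over a local ring. -/

namespace Polynomial

variable {A : Type*} [CommRing A]

/-- With `c` the coefficient of `g` in degree `deg f - 1`, the element `X g - c f` of `I` again has
degree below `deg f`, and its coefficients are those of `g` moved up by one, modulo `c ∈ J`.
Repeating this brings every coefficient of `g` to the top position. -/
theorem coeff_mem_of_forall_coeff_pred_mem {f : A[X]} (hf : f.Monic) {I : Ideal A[X]} (hfI : f ∈ I)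
    {J : Ideal A} (hJ : ∀ h ∈ I, h.degree < f.degree → h.coeff (f.natDegree - 1) ∈ J)
    (m : ℕ) {g : A[X]} (hg : g ∈ I) (hd : g.degree < f.degree) (hm : m + 1 ≤ f.natDegree) :
    g.coeff (f.natDegree - 1 - m) ∈ J := by
  nontriviality A
  induction m generalizing g with
  | zero => simpa using hJ g hg hd
  | succ m ih =>
    set d := f.natDegree with hdd
    set c := g.coeff (d - 1) with hc
    have hcJ : c ∈ J := hJ g hg hd
    have hX : X * g - C c * f ∈ I := I.sub_mem (I.mul_mem_left _ hg) (I.mul_mem_left _ hfI)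
    have hdeg : (X * g - C c * f).degree < f.degree := by
      rw [degree_eq_natDegree hf.ne_zero, degree_lt_iff_coeff_zero]
      intro k hk
      rw [degree_eq_natDegree hf.ne_zero, degree_lt_iff_coeff_zero] at hd
      obtain ⟨k, rfl⟩ : ∃ k', k = k' + 1 := ⟨k - 1, by omega⟩
      rw [coeff_sub, coeff_X_mul, coeff_C_mul]
      rcases eq_or_lt_of_le hk with h | h
      · rw [← h, ← hdd, hf.coeff_natDegree, hc, hdd, h]; simp
      · rw [hd k (by omega), coeff_eq_zero_of_natDegree_lt (p := f) (by omega)]; simp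
    have := ih hX hdeg (by omega)
    rw [coeff_sub, coeff_C_mul, show d - 1 - m = d - 1 - (m + 1) + 1 by omega, coeff_X_mul] at this
    exact (Submodule.sub_mem_iff_left _ (J.mul_mem_right _ hcJ)).1 this

/-- If `f` is monic and `g` of smaller degree has a unit coefficient, then the ideal `(f, g)`
contains a monic polynomial of degree `deg f - 1`. -/
theorem exists_combination_coeff_eq_one {f g : A[X]} (hf : f.Monic)
    (hd : g.degree < f.degree) {b : ℕ} (hb : IsUnit (g.coeff b)) :
    ∃ p q : A[X], (p * f + q * g).degree < f.degree ∧
      (p * f + q * g).coeff (f.natDegree - 1) = 1 := by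
  have : Nontrivial A := by
    by_contra h
    rw [not_nontrivial_iff_subsingleton] at h
    simp [Subsingleton.elim f 0, Subsingleton.elim g 0] at hd
  let J : Ideal A :=
    { carrier := {a | ∃ p q : A[X], (p * f + q * g).degree < f.degree ∧
        (p * f + q * g).coeff (f.natDegree - 1) = a}
      zero_mem' := ⟨0, 0, by simpa [bot_lt_iff_ne_bot] using hf.ne_zero, by simp⟩
      add_mem' := by
        rintro a a' ⟨p, q, h, rfl⟩ ⟨p', q', h', rfl⟩
        have e : (p + p') * f + (q + q') * g = (p * f + q * g) + (p' * f + q' * g) := by ring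
        exact ⟨p + p', q + q', e ▸ (degree_add_le _ _).trans_lt (max_lt h h'), by
          rw [e, coeff_add]⟩
      smul_mem' := by
        rintro c a ⟨p, q, h, rfl⟩
        have e : (C c * p) * f + (C c * q) * g = C c * (p * f + q * g) := by ring
        refine ⟨C c * p, C c * q, ?_, by rw [e, coeff_C_mul, smul_eq_mul]⟩
        rw [e]
        refine lt_of_le_of_lt ?_ h
        rw [← smul_eq_C_mul]
        exact degree_smul_le _ _ }
  have hbd : b < f.natDegree := by
    by_contra! h
    rw [degree_eq_natDegree hf.ne_zero, degree_lt_iff_coeff_zero] at hd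
    rw [hd b h] at hb
    exact not_isUnit_zero hb
  have hmem : g.coeff (f.natDegree - 1 - (f.natDegree - 1 - b)) ∈ J := by
    refine coeff_mem_of_forall_coeff_pred_mem hf (I := Ideal.span {f, g})
      (Ideal.subset_span (by simp)) ?_ _ (Ideal.subset_span (by simp)) hd (by omega)
    intro h hI hdeg
    obtain ⟨p, q, rfl⟩ := Ideal.mem_span_pair.1 hI
    exact ⟨p, q, hdeg, rfl⟩
  rw [show f.natDegree - 1 - (f.natDegree - 1 - b) = b by omega] at hmem
  exact (Ideal.eq_top_iff_one J).1 (J.eq_top_of_isUnit_mem hmem hb)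

end Polynomial

namespace IsUnimodularVec

variable {A : Type*} [CommRing A]

/-- **Horrocks' theorem** for vectors: over a polynomial ring over a local ring, a unimodular
vector with a monic entry is equivalent to a standard basis vector. -/
theorem exists_rowEquiv_single_of_monic [IsLocalRing A] {n : ℕ} {v : Fin n → A[X]}
    (hv : IsUnimodularVec v) {i : Fin n} (hi : (v i).Monic) :
    ∃ j, RowEquiv v (Pi.single j 1) := by
  obtain ⟨d, hd⟩ : ∃ d, (v i).natDegree = d := ⟨_, rfl⟩
  induction d using Nat.strong_induction_on generalizing v i with
  | _ d ih =>
  match n, v, i with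
  | 0, _, i => exact i.elim0
  | 1, v, i => exact ⟨_, hv.rowEquiv_single_one⟩
  | 2, v, i => exact ⟨_, hv.rowEquiv_single_two⟩
  | n + 3, v, i =>
  rcases Nat.eq_zero_or_pos d with h0 | hpos
  · exact ⟨i, RowEquiv.single_of_eq_one v i (hi.natDegree_eq_zero.1 (hd.trans h0))⟩
  classical
  -- Divide the other entries by the monic one, so that they all have degree below `d`.
  set v' : Fin (n + 3) → A[X] := fun j => if j = i then v i else v j %ₘ v i with hv'
  have hequiv : RowEquiv v v' := by
    convert RowEquiv.add_mul v i (fun j => if j = i then 0 else - (v j /ₘ v i)) (by simp) using 1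
    ext1 j
    rcases eq_or_ne j i with rfl | hj
    · simp [hv']
    · simp only [hv', hj, if_false]
      rw [modByMonic_eq_sub_mul_div]; ring
  have hvi : v' i = v i := by simp [hv']
  have hdeg : ∀ j, j ≠ i → (v' j).degree < (v i).degree := fun j hj => by
    simpa [hv', hj] using degree_modByMonic_lt _ hi
  have huv' := hequiv.isUnimodularVec hv
  -- Otherwise only the entry `i` survives over the residue field. It would then be a monic unit,
  -- hence `1`, against `d > 0`.
  obtain ⟨j, b, hj, hb⟩ : ∃ j b, j ≠ i ∧ IsUnit ((v' j).coeff b) := by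
    by_contra! hcon
    have hu := huv'.map (mapRingHom (IsLocalRing.residue A))
    obtain ⟨u, hu⟩ := hu
    have hz : ∀ j, j ≠ i → mapRingHom (IsLocalRing.residue A) (v' j) = 0 := by
      intro j hj
      ext b
      have := hcon j b hj
      simpa using this
    rw [dotProduct, Finset.sum_eq_single i] at hu
    · have hm : (mapRingHom (IsLocalRing.residue A) (v i)).Monic := hi.map _
      simp only [Function.comp, hvi] at hu
      have h1 := hm.eq_one_of_isUnit (IsUnit.of_mul_eq_one _ ((mul_comm _ _).trans hu))
      have h2 : (mapRingHom (IsLocalRing.residue A) (v i)).natDegree = d := by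
        rw [coe_mapRingHom, hi.natDegree_map, hd]
      rw [h1] at h2
      simp at h2
      omega
    · intro k _ hk
      simp only [Function.comp, hz k hk, mul_zero]
    · simp
  -- A third position is free to receive a combination of the entries `i` and `j`. The factor `1 -
  -- c` below makes its coefficient in degree `d - 1` equal to `1`, giving a monic entry of degree
  -- `d - 1`.
  obtain ⟨k, hki, hkj⟩ : ∃ k : Fin (n + 3), k ≠ i ∧ k ≠ j := by
    have : ({i, j} : Finset (Fin (n + 3))).card < Fintype.card (Fin (n + 3)) :=
      (Finset.card_le_two).trans_lt (by simp)
    obtain ⟨k, hk⟩ := Finset.exists_mem_notMem_of_card_lt_card (s := {i, j})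
      (t := Finset.univ) (by simpa using this)
    exact ⟨k, by simpa using hk⟩
  obtain ⟨p, q, hpq, hpq1⟩ := exists_combination_coeff_eq_one hi (hdeg j hj) hb
  rw [hd] at hpq1
  set c := (v' k).coeff (d - 1)
  set x := C (1 - c) * (p * v i + q * v' j) with hx
  have hequiv2 : RowEquiv v' (Function.update v' k (v' k + x)) := by
    refine RowEquiv.update_add v'
      (Pi.single i (C (1 - c) * p) + Pi.single j (C (1 - c) * q)) (by simp [hki, hkj]) ?_
    rw [add_dotProduct, single_dotProduct, single_dotProduct, hvi, hx]; ring
  have hkdeg : (v' k + x).degree < (v i).degree := by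
    refine (degree_add_le _ _).trans_lt (max_lt (hdeg k hki) ?_)
    rw [hx, ← smul_eq_C_mul]
    exact (degree_smul_le _ _).trans_lt hpq
  have hkc : (v' k + x).coeff (d - 1) = 1 := by
    rw [coeff_add, hx, coeff_C_mul, hpq1]; ring
  have hle : (v' k + x).natDegree ≤ d - 1 := by
    rw [natDegree_le_iff_degree_le]
    rw [degree_eq_natDegree hi.ne_zero, hd] at hkdeg
    rw [degree_le_iff_coeff_zero]
    intro m hm
    refine coeff_eq_zero_of_degree_lt (hkdeg.trans_le ?_)
    have : d - 1 < m := by exact_mod_cast hm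
    exact_mod_cast (by omega : d ≤ m)
  have hmon : (v' k + x).Monic := monic_of_natDegree_le_of_coeff_eq_one _ hle hkc
  obtain ⟨l, hl⟩ := ih (v' k + x).natDegree (by omega) (hequiv2.isUnimodularVec huv') (i := k)
    (by simpa using hmon) (by simp)
  exact ⟨l, hequiv.trans (hequiv2.trans hl)⟩

end IsUnimodularVec

/-! ### Quillen's patching: from localizations to the base ring. -/

namespace Polynomial

variable {A : Type*} [CommRing A]

/-- The substitution `X ↦ X + c Y` as a map from polynomials in `X` to polynomials in `X` and
`Y`. -/
noncomputable def shiftHom (c : A) : A[X] →+* A[X][X] :=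
  eval₂RingHom (C.comp C) (C X + C (C c) * X)

@[simp]
theorem shiftHom_C (c a : A) : shiftHom c (C a) = C (C a) := by simp [shiftHom]

@[simp]
theorem shiftHom_X (c : A) : shiftHom c X = C X + C (C c) * X := by simp [shiftHom]

theorem shiftHom_map {B : Type*} [CommRing B] (f : A →+* B) (c : A) (p : A[X]) :
    mapRingHom (mapRingHom f) (shiftHom c p) = shiftHom (f c) (mapRingHom f p) := by
  have : (mapRingHom (mapRingHom f)).comp (shiftHom c) =
      (shiftHom (f c)).comp (mapRingHom f) := by
    ext <;> simp
  exact congr($this p)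

theorem shiftHom_eq_comp (c : A) (p : A[X]) :
    shiftHom c p = (shiftHom 1 p).comp (C (C c) * X) := by
  have : shiftHom c = (compRingHom (C (C c) * X)).comp (shiftHom 1) := by
    ext <;> simp
  exact congr($this p)

theorem coeff_zero_shiftHom (c : A) (p : A[X]) : (shiftHom c p).coeff 0 = p := by
  have : (constantCoeff (R := A[X])).comp (shiftHom c) = RingHom.id _ := by
    ext <;> simp
  exact congr($this p)

end Polynomial

/-- The elements `c` for which `v(X + cY)` and `v(X)` are equivalent form an ideal. -/
def shiftIdeal {A : Type*} [CommRing A] {n : ℕ} (v : Fin n → A[X]) : Ideal A where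
  carrier := {c | RowEquiv (shiftHom c ∘ v) (C ∘ v)}
  zero_mem' := by
    have : (shiftHom 0 : A[X] →+* A[X][X]) = C := by ext <;> simp
    simpa [this] using RowEquiv.refl _
  add_mem' := by
    intro a b ha hb
    let θ : A[X][X] →+* A[X][X] := eval₂RingHom (shiftHom b) X
    have h1 : θ.comp (shiftHom a) = shiftHom (a + b) := by
      ext
      · simp [θ]
      · simp only [RingHom.coe_comp, Function.comp, shiftHom_X, map_add, map_mul, θ,
          coe_eval₂RingHom, eval₂_C, eval₂_X, shiftHom_C]
        rw [add_assoc, ← add_mul, add_comm (C (C b))]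
    have h2 : θ.comp C = shiftHom b := by
      ext <;> simp [θ]
    have := ha.map θ
    rw [← Function.comp_assoc, ← Function.comp_assoc, ← RingHom.coe_comp, ← RingHom.coe_comp,
      h1, h2] at this
    exact this.trans hb
  smul_mem' := by
    intro a c hc
    let θ : A[X][X] →+* A[X][X] := compRingHom (C (C a) * X)
    have h1 : θ.comp (shiftHom c) = shiftHom (a * c) := by
      ext
      · simp [θ]
      · simp only [RingHom.coe_comp, Function.comp, shiftHom_X, map_add, map_mul, θ,
          coe_compRingHom, C_comp, X_comp]
        rw [← mul_assoc, mul_comm (C (C c))]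
    have h2 : θ.comp C = C := by
      ext <;> simp [θ]
    have := hc.map θ
    rw [← Function.comp_assoc, ← Function.comp_assoc, ← RingHom.coe_comp, ← RingHom.coe_comp,
      h1, h2] at this
    exact this

theorem mem_shiftIdeal {A : Type*} [CommRing A] {n : ℕ} {v : Fin n → A[X]} {c : A} :
    c ∈ shiftIdeal v ↔ RowEquiv (shiftHom c ∘ v) (C ∘ v) := Iff.rfl

/-- For `c = 1`, specialise the equivalence of `v(X + Y)` and `v(X)` to `X = 0` and then rename `Y`
to `X`. -/
theorem rowEquiv_eval_zero_of_shiftIdeal_eq_top {A : Type*} [CommRing A] {n : ℕ}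
    {v : Fin n → A[X]} (h : shiftIdeal v = ⊤) : RowEquiv v (C ∘ eval 0 ∘ v) := by
  have h1 : (1 : A) ∈ shiftIdeal v := h ▸ Submodule.mem_top
  let θ : A[X][X] →+* A[X] := eval₂RingHom (C.comp (evalRingHom 0)) X
  have := (mem_shiftIdeal.1 h1).map θ
  have e1 : θ.comp (shiftHom 1) = RingHom.id _ := by
    ext <;> simp [θ]
  have e2 : θ.comp C = C.comp (evalRingHom 0) := by
    ext <;> simp [θ]
  rw [← Function.comp_assoc, ← Function.comp_assoc, ← RingHom.coe_comp, ← RingHom.coe_comp,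
      e1, e2] at this
  exact this

/-- Clearing denominators in a polynomial in two variables whose coefficients of `Y ^ 0` are
already integral, by rescaling the variable `Y`. -/
theorem IsLocalization.exists_comp_mem_range {A L : Type*} [CommRing A] [CommRing L] [Algebra A L]
    (S : Submonoid A) [IsLocalization S L] (p : L[X][X])
    (hp : p.coeff 0 ∈ (mapRingHom (algebraMap A L)).range) :
    ∃ c ∈ S, ∀ a, p.comp (C (C (algebraMap A L (c * a))) * X) ∈
      (mapRingHom (mapRingHom (algebraMap A L))).range := by
  classical
  obtain ⟨c, hc⟩ := IsLocalization.exist_integer_multiples_of_finset S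
    (p.support.biUnion fun j => (p.coeff j).support.image fun k => (p.coeff j).coeff k)
  have hc' : ∀ j k, ∃ b, algebraMap A L b = algebraMap A L c * (p.coeff j).coeff k := by
    intro j k
    by_cases h : (p.coeff j).coeff k = 0
    · exact ⟨0, by simp [h]⟩
    have hj : p.coeff j ≠ 0 := fun h' => h (by simp [h'])
    obtain ⟨b, hb⟩ := hc ((p.coeff j).coeff k) (by
      simp only [Finset.mem_biUnion, Finset.mem_image]
      exact ⟨j, by simpa using hj, k, by simpa using h, rfl⟩)
    exact ⟨b, by rw [hb, Algebra.smul_def]⟩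
  refine ⟨c, c.2, fun a => ?_⟩
  rw [mem_map_range]
  intro j
  rw [comp_C_mul_X_coeff, ← C_pow, mul_comm, ← smul_eq_C_mul]
  cases j with
  | zero => simpa using hp
  | succ j =>
    rw [mem_map_range]
    intro k
    obtain ⟨b, hb⟩ := hc' (j + 1) k
    -- The coefficient of `Y ^ (j + 1)` is multiplied by `(c a) ^ (j + 1)`; one factor `c` is spent
    -- on the denominator.
    refine ⟨(c * a) ^ j * a * b, ?_⟩
    rw [coeff_smul, smul_eq_mul, map_mul, map_mul, hb, pow_succ, map_pow, map_mul]
    ring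

section Patching

variable {A L : Type*} [CommRing A] [CommRing L] [Algebra A L]

/-- The product of the individual denominators works, since the single case tolerates an arbitrary
extra factor `a`. -/
theorem IsLocalization.exists_forall_comp_mem_range {ι : Type*} [Finite ι]
    (S : Submonoid A) [IsLocalization S L] (p : ι → L[X][X])
    (hp : ∀ i, (p i).coeff 0 ∈ (mapRingHom (algebraMap A L)).range) :
    ∃ c ∈ S, ∀ i, (p i).comp (C (C (algebraMap A L c)) * X) ∈
      (mapRingHom (mapRingHom (algebraMap A L))).range := by
  classical
  have := Fintype.ofFinite ι
  choose c hc h using fun i => exists_comp_mem_range S (p i) (hp i)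
  refine ⟨∏ i, c i, Submonoid.prod_mem S fun i _ => hc i, fun i => ?_⟩
  rw [← Finset.mul_prod_erase _ _ (Finset.mem_univ i)]
  exact h i _

/-- If `v(X)` and `v(0)` are equivalent over a localization of a domain, then `v(X + cY)` and
`v(X)` are equivalent for some denominator `c`. -/
theorem exists_mem_shiftIdeal (S : Submonoid A) [IsLocalization S L]
    (hinj : Function.Injective (algebraMap A L)) {n : ℕ} {v : Fin n → A[X]}
    (h : RowEquiv (mapRingHom (algebraMap A L) ∘ v)
      (C ∘ eval 0 ∘ (mapRingHom (algebraMap A L) ∘ v))) :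
    ∃ c ∈ S, c ∈ shiftIdeal v := by
  set φ := mapRingHom (algebraMap A L)
  set Φ : A[X][X] →+* L[X][X] := mapRingHom φ
  have hΦ : Function.Injective Φ := map_injective _ (map_injective _ hinj)
  obtain ⟨g, h, hgh, hhg, hv⟩ := h
  -- `g(X) v(X) = v(0)`
  have hmap : ∀ f : L[X] →+* L[X][X], g.map f * h.map f = 1 ∧ h.map f * g.map f = 1 := by
    intro f
    constructor
    · rw [← Matrix.map_mul, hgh, Matrix.map_one f (map_zero f) (map_one f)]
    · rw [← Matrix.map_mul, hhg, Matrix.map_one f (map_zero f) (map_one f)]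
  -- `G = g(X)⁻¹ g(X + Y)` takes `v(X + Y)` to `v(X)`, through `v(0)`. It is the identity at `Y =
  -- 0`, so the substitution `Y ↦ cY` clears the denominators of `G` and of its inverse `G'`.
  set G := h.map C * g.map (shiftHom (1 : L)) with hG
  set G' := h.map (shiftHom (1 : L)) * g.map C with hG'
  have hcoeff : ∀ M : Matrix (Fin n) (Fin n) L[X][X], M.map (constantCoeff (R := L[X])) = 1 →
      ∀ i : Fin n × Fin n, (M i.1 i.2).coeff 0 ∈ φ.range := by
    intro M hM i
    have : (M i.1 i.2).coeff 0 = (1 : Matrix (Fin n) (Fin n) L[X]) i.1 i.2 := by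
      rw [← hM]; rfl
    rw [this, Matrix.one_apply]
    split_ifs
    exacts [one_mem _, zero_mem _]
  have hmm : ∀ (M : Matrix (Fin n) (Fin n) L[X]) (a : L),
      (M.map (shiftHom a)).map (constantCoeff (R := L[X])) = M := by
    intro M a; ext1 i j; exact coeff_zero_shiftHom a _
  have hmC : ∀ (M : Matrix (Fin n) (Fin n) L[X]),
      (M.map C).map (constantCoeff (R := L[X])) = M := by
    intro M; ext1 i j; simp
  obtain ⟨c, hcS, hc⟩ := IsLocalization.exists_forall_comp_mem_range (L := L) S
    (Sum.elim (fun i : Fin n × Fin n => G i.1 i.2) (fun i : Fin n × Fin n => G' i.1 i.2)) (by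
      rintro (i | i)
      · exact hcoeff G (by rw [hG, Matrix.map_mul, hmm, hmC, hhg]) i
      · exact hcoeff G' (by rw [hG', Matrix.map_mul, hmm, hmC, hhg]) i)
  refine ⟨c, hcS, ?_⟩
  choose H hH using fun i j => hc (Sum.inl (i, j))
  choose H' hH' using fun i j => hc (Sum.inr (i, j))
  set a := algebraMap A L c with ha
  set κ : L[X][X] →+* L[X][X] := compRingHom (C (C a) * X) with hκ
  have hκs : κ.comp (shiftHom 1) = shiftHom a := RingHom.ext fun p => (shiftHom_eq_comp a p).symm
  have hκC : κ.comp C = C := by ext <;> simp [κ]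
  have hHG : (Matrix.of H).map Φ = h.map C * g.map (shiftHom a) := by
    have : (Matrix.of H).map Φ = G.map κ := by ext1 i j; exact hH i j
    rw [this, hG, Matrix.map_mul, Matrix.map_map, Matrix.map_map, ← RingHom.coe_comp,
      ← RingHom.coe_comp, hκs, hκC]
  have hHG' : (Matrix.of H').map Φ = h.map (shiftHom a) * g.map C := by
    have : (Matrix.of H').map Φ = G'.map κ := by ext1 i j; exact hH' i j
    rw [this, hG', Matrix.map_mul, Matrix.map_map, Matrix.map_map, ← RingHom.coe_comp,
      ← RingHom.coe_comp, hκs, hκC]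
  have hinjM : Function.Injective fun M : Matrix (Fin n) (Fin n) A[X][X] => M.map Φ :=
    Matrix.map_injective hΦ
  refine ⟨Matrix.of H, Matrix.of H', ?_, ?_, ?_⟩
  · apply hinjM
    beta_reduce
    rw [Matrix.map_mul, hHG, hHG', Matrix.map_one Φ (map_zero Φ) (map_one Φ), Matrix.mul_assoc,
      ← Matrix.mul_assoc (g.map _), (hmap _).1, Matrix.one_mul, (hmap _).2]
  · apply hinjM
    beta_reduce
    rw [Matrix.map_mul, hHG, hHG', Matrix.map_one Φ (map_zero Φ) (map_one Φ), Matrix.mul_assoc,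
      ← Matrix.mul_assoc (g.map _), (hmap _).1, Matrix.one_mul, (hmap _).2]
  · have hgv : ∀ f : L[X] →+* L[X][X], f.comp C = C.comp C →
        g.map f *ᵥ (f ∘ φ ∘ v) = C ∘ C ∘ eval 0 ∘ φ ∘ v := by
      intro f hf
      have h1 : f ∘ (g *ᵥ (φ ∘ v)) = g.map f *ᵥ (f ∘ φ ∘ v) := by
        ext1 i; exact RingHom.map_mulVec f g _ i
      rw [← h1, hv]
      ext1 i
      exact congr($hf _)
    have hs : shiftHom a ∘ φ ∘ v = Φ ∘ shiftHom c ∘ v := by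
      ext1 i; exact (shiftHom_map (algebraMap A L) c (v i)).symm
    have hC : C ∘ φ ∘ v = Φ ∘ C ∘ v := by
      ext1 i; simp [Φ]
    have h1 := hgv (shiftHom a) (by ext1; simp)
    have h2 := hgv C rfl
    have : Φ ∘ (Matrix.of H *ᵥ (shiftHom c ∘ v)) = Φ ∘ (C ∘ v) := by
      have e : Φ ∘ (Matrix.of H *ᵥ (shiftHom c ∘ v)) =
          (Matrix.of H).map Φ *ᵥ (Φ ∘ shiftHom c ∘ v) := by
        ext1 i; exact RingHom.map_mulVec Φ _ _ i
      rw [e, hHG, ← hs, ← mulVec_mulVec, h1, ← h2, mulVec_mulVec, (hmap C).2, one_mulVec, hC]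
    ext1 i
    exact hΦ (congrFun this i)

end Patching

/-- Over a polynomial ring over a domain, a unimodular vector `v(X)` with a monic entry is
equivalent to `v(0)`. -/
theorem IsUnimodularVec.rowEquiv_eval_zero {A : Type*} [CommRing A] [IsDomain A] {n : ℕ}
    {v : Fin n → A[X]} (hv : IsUnimodularVec v) {i : Fin n} (hi : (v i).Monic) :
    RowEquiv v (C ∘ eval 0 ∘ v) := by
  apply rowEquiv_eval_zero_of_shiftIdeal_eq_top
  by_contra htop
  obtain ⟨m, hm, hle⟩ := Ideal.exists_le_maximal _ htop
  let L := Localization.AtPrime m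
  obtain ⟨j, hj⟩ := (hv.map (mapRingHom (algebraMap A L))).exists_rowEquiv_single_of_monic
    (i := i) (hi.map _)
  obtain ⟨c, hcS, hc⟩ := exists_mem_shiftIdeal (L := L) m.primeCompl
    -- Setting `X = 0` in the equivalence of `v(X)` with a basis vector shows that `v(0)` is
    -- equivalent to the same vector.
    (IsLocalization.injective _ m.primeCompl_le_nonZeroDivisors) (v := v) (by
      refine hj.trans ?_
      have h0 := (hj.map (C.comp (evalRingHom 0))).symm
      have e : (C.comp (evalRingHom 0)) ∘ (Pi.single j 1 : Fin n → L[X]) = Pi.single j 1 := by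
        ext1 k
        by_cases hk : k = j
        · subst hk; simp
        · simp [hk]
      rw [e] at h0
      exact h0)
  exact hcS (hle hc)

/-! ### Completing unimodular vectors by Weierstrass preparation. -/

/-- Every finitely generated projective module is free. -/
def ProjectiveFree (A : Type u) [CommRing A] : Prop :=
  ∀ (M : Type u) [AddCommGroup M] [Module A M] [Module.Finite A M] [Module.Projective A M],
    Module.Free A M

/-- `B` behaves like a ring of power series over `A` with Weierstrass preparation and division:
every nonzero element of `B` is associated to the image of a monic polynomial `w` under some ring
homomorphism `A[X] → B` that induces an isomorphism modulo `w`. -/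
def WeierstrassOver (A B : Type*) [CommRing A] [CommRing B] : Prop :=
  ∀ g : B, g ≠ 0 → ∃ (ι : A[X] →+* B) (w : A[X]), w.Monic ∧ Associated g (ι w) ∧
    (∀ b, ∃ p, ι w ∣ b - ι p) ∧ (∀ p, ι w ∣ ι p → w ∣ p)

namespace ProjectiveFree

/-- The functional `v ⬝ᵥ ·` is a split surjection onto `A`, so its kernel is projective, hence free.
A basis of the kernel and a splitting give an invertible matrix with first row `v`; its transpose
takes the first basis vector to `v`. -/
theorem rowEquiv_single {A : Type u} [CommRing A] [Nontrivial A] (hA : ProjectiveFree A) {n : ℕ}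
    {v : Fin n → A} (hv : IsUnimodularVec v) : ∃ j, RowEquiv v (Pi.single j 1) := by
  obtain ⟨y, hy⟩ := hv
  let π : (Fin n → A) →ₗ[A] A := dotProductBilin A A v
  have hπ : ∀ z, π z = v ⬝ᵥ z := fun z => rfl
  have hsurj : Function.Surjective π := fun a => ⟨a • y, by
    rw [map_smul, hπ, dotProduct_comm, hy, smul_eq_mul, mul_one]⟩
  have hexact : Function.Exact (LinearMap.ker π).subtype π := LinearMap.exact_subtype_ker_map π
  obtain ⟨s, hs⟩ := π.exists_rightInverse_of_surjective (LinearMap.range_eq_top.2 hsurj)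
  obtain ⟨e, he, he'⟩ :=
    ((hexact.split_tfae Subtype.val_injective hsurj).out 0 2 :
      (∃ l, π ∘ₗ l = LinearMap.id) ↔ ∃ e : (Fin n → A) ≃ₗ[A] LinearMap.ker π × A, _).1 ⟨s, hs⟩
  have hfin : Module.Finite A (LinearMap.ker π) := by
    refine Module.Finite.of_surjective (LinearMap.fst A _ A ∘ₗ e.toLinearMap) ?_
    rw [LinearMap.coe_comp]
    exact Prod.fst_surjective.comp e.surjective
  have hproj : Module.Projective A (LinearMap.ker π) := by
    refine Module.Projective.of_split (LinearMap.ker π).subtype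
      (LinearMap.fst A _ A ∘ₗ e.toLinearMap) ?_
    rw [he]; ext1 x; simp
  have hfree := hA (LinearMap.ker π)
  obtain ⟨k, b⟩ : ∃ k, Nonempty (Module.Basis (Fin k) A (LinearMap.ker π)) :=
    ⟨_, ⟨Module.finBasis A _⟩⟩
  let ψ : (Fin n → A) ≃ₗ[A] (Fin (k + 1) → A) :=
    e ≪≫ₗ (b.some.equivFun.prodCongr (LinearEquiv.refl A A)) ≪≫ₗ LinearEquiv.prodComm A _ _ ≪≫ₗ
      Fin.consLinearEquiv A (fun _ => A)
  obtain rfl : n = k + 1 := by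
    have := LinearEquiv.finrank_eq ψ
    simpa using this
  have hψ : ∀ z, ψ z 0 = v ⬝ᵥ z := by
    intro z
    rw [← hπ, he']
    simp [ψ]
  refine ⟨0, RowEquiv.symm ?_⟩
  refine ⟨(LinearMap.toMatrix' ψ.toLinearMap)ᵀ, (LinearMap.toMatrix' ψ.symm.toLinearMap)ᵀ,
    ?_, ?_, ?_⟩
  · rw [← transpose_mul, ← LinearMap.toMatrix'_comp]; simp
  · rw [← transpose_mul, ← LinearMap.toMatrix'_comp]; simp
  · ext j
    rw [mulVec_single_one]
    simp only [col_apply, transpose_apply, LinearMap.toMatrix'_apply]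
    simpa using hψ (Pi.single j 1)

end ProjectiveFree

namespace WeierstrassOver

/-- Unimodular vectors over `B` are equivalent to standard basis vectors. -/
theorem rowEquiv_single {A : Type u} {B : Type*} [CommRing A] [IsDomain A] [CommRing B]
    [Nontrivial B] (hAB : WeierstrassOver A B) (hA : ProjectiveFree A) {n : ℕ} {v : Fin n → B}
    (hv : IsUnimodularVec v) : ∃ j, RowEquiv v (Pi.single j 1) := by
  obtain ⟨i, hi⟩ : ∃ i, v i ≠ 0 := by
    by_contra! h
    obtain ⟨u, hu⟩ := hv
    simp [funext h, dotProduct] at hu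
  obtain ⟨ι, w, hw, ⟨c, hc⟩, hdiv, hinj⟩ := hAB (v i) hi
  have h1 := RowEquiv.smul_unit v c
  choose p hp using fun j => hdiv (c * v j)
  choose q hq using hp
  set P : Fin n → A[X] := Function.update p i w with hP
  have h2 : RowEquiv (fun j => c * v j) (ι ∘ P) := by
    convert RowEquiv.add_mul (fun j => (c : B) * v j) i (Function.update (-q) i 0) (by simp) using 1
    ext1 j
    rcases eq_or_ne j i with rfl | hj
    · simp [hP, ← hc, mul_comm]
    · simp only [hP, Function.comp, Function.update_of_ne hj, Pi.neg_apply]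
      rw [mul_comm (c : B) (v i), hc]
      linear_combination - hq j
  have hPi : P i = w := by simp [hP]
  -- Unimodularity descends from `B` to `A[X]`: lift the coefficients of a relation modulo `w`. The
  -- error is divisible by `w`, already in `A[X]`, and is absorbed by the entry `w`.
  have hPu : IsUnimodularVec P := by
    obtain ⟨u, hu⟩ := (h1.trans h2).isUnimodularVec hv
    choose a ha using fun j => hdiv (u j)
    have : ι w ∣ ι (1 - a ⬝ᵥ P) := by
      rw [map_sub, map_one, ← hu, RingHom.map_dotProduct, ← sub_dotProduct]
      exact Finset.dvd_sum fun j _ => Dvd.dvd.mul_right (ha j) _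
    obtain ⟨r, hr⟩ := hinj _ this
    refine ⟨a + Pi.single i r, ?_⟩
    rw [add_dotProduct, single_dotProduct, hPi]
    linear_combination - hr
  have h3 := hPu.rowEquiv_eval_zero (i := i) (hPi ▸ hw)
  have h4 := hPu.map (evalRingHom 0)
  obtain ⟨j, hj⟩ := hA.rowEquiv_single h4
  have h5 := h3.trans (hj.map C)
  refine ⟨j, (h1.trans h2).trans ?_⟩
  convert h5.map ι using 1
  ext1 k
  by_cases hk : k = j
  · subst hk; simp
  · simp [hk]

end WeierstrassOver

/-! ### Stably free modules are free. -/

section Cancellation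

variable {B : Type*} [CommRing B]

/-- Through `φ`, the projection to the factor `B` becomes `v ⬝ᵥ ·` with `v` unimodular. A change of
basis turns this functional into the coordinate `j`, and its kernel `Q` is free on the remaining
coordinates. -/
theorem Module.Free.of_prod_self_of_rowEquiv
    (hB : ∀ (n : ℕ) (v : Fin n → B), IsUnimodularVec v → ∃ j, RowEquiv v (Pi.single j 1))
    {Q : Type*} [AddCommGroup Q] [Module B Q] {m : ℕ} (φ : (Q × B) ≃ₗ[B] (Fin m → B)) :
    Module.Free B Q := by
  classical
  let v : Fin m → B := fun j => (φ.symm (Pi.single j 1)).2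
  have hv : ∀ z, (φ.symm z).2 = v ⬝ᵥ z := by
    intro z
    have : (LinearMap.snd B Q B ∘ₗ φ.symm.toLinearMap) = dotProductBilin B B v := by
      refine LinearMap.pi_ext' fun j => LinearMap.ext_ring ?_
      simp [v, dotProductBilin]
    exact congr($this z)
  have huni : IsUnimodularVec v := ⟨φ (0, 1), by
    rw [dotProduct_comm, ← hv]; simp⟩
  obtain ⟨j, hj⟩ := hB m v huni
  obtain ⟨g, h, h1, h2, h3⟩ := hj.symm
  have hT1 : gᵀ * hᵀ = 1 := by rw [← transpose_mul, h2, transpose_one]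
  have hT2 : hᵀ * gᵀ = 1 := by rw [← transpose_mul, h1, transpose_one]
  have hv' : ∀ z, (φ.symm z).2 = (gᵀ *ᵥ z) j := by
    intro z
    rw [hv, ← h3, mulVec_transpose, dotProduct_comm, dotProduct_mulVec]
    simp
  let f : Q →ₗ[B] ({k // k ≠ j} → B) :=
    LinearMap.funLeft B B Subtype.val ∘ₗ gᵀ.mulVecLin ∘ₗ φ.toLinearMap ∘ₗ LinearMap.inl B Q B
  have hf : ∀ q k, f q k = (gᵀ *ᵥ φ (q, 0)) k := fun q k => rfl
  have hfj : ∀ q, (gᵀ *ᵥ φ (q, 0)) j = 0 := fun q => by rw [← hv']; simp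
  have hbij : Function.Bijective f := by
    constructor
    · rw [← LinearMap.ker_eq_bot, LinearMap.ker_eq_bot']
      intro q hq
      have : gᵀ *ᵥ φ (q, 0) = 0 := by
        ext k
        by_cases hk : k = j
        · rw [hk, hfj]; rfl
        · exact (hf q ⟨k, hk⟩).symm.trans (congrFun hq _)
      have h0 : φ (q, 0) = 0 := by
        rw [← one_mulVec (φ (q, 0)), ← hT2, ← mulVec_mulVec, this, mulVec_zero]
      simpa using h0
    · intro z
      let z' : Fin m → B := fun k => if hk : k = j then 0 else z ⟨k, hk⟩
      have hz' : gᵀ *ᵥ (hᵀ *ᵥ z') = z' := by rw [mulVec_mulVec, hT1, one_mulVec]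
      refine ⟨(φ.symm (hᵀ *ᵥ z')).1, ?_⟩
      have h0 : (φ.symm (hᵀ *ᵥ z')).2 = 0 := by
        rw [hv', hz']; simp [z']
      ext k
      rw [hf]
      have : ((φ.symm (hᵀ *ᵥ z')).1, (0 : B)) = φ.symm (hᵀ *ᵥ z') := Prod.ext rfl h0.symm
      rw [this, LinearEquiv.apply_symm_apply, hz']
      simp [z', k.2]
  exact Module.Free.of_equiv (LinearEquiv.ofBijective f hbij).symm

/-- If unimodular vectors can be completed, stably free modules are free. -/
theorem Module.Free.of_prod_pi_of_rowEquiv [Nontrivial B]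
    (hB : ∀ (n : ℕ) (v : Fin n → B), IsUnimodularVec v → ∃ j, RowEquiv v (Pi.single j 1))
    {Q : Type*} [AddCommGroup Q] [Module B Q] [Module.Finite B Q] (s : ℕ)
    (h : Module.Free B (Q × (Fin s → B))) : Module.Free B Q := by
  induction s with
  | zero => exact Module.Free.of_equiv (LinearEquiv.prodUnique (R := B) (M := Q) (M₂ := Fin 0 → B))
  | succ s ih =>
    have e : (Q × (Fin (s + 1) → B)) ≃ₗ[B] (Q × (Fin s → B)) × B :=
      ((LinearEquiv.refl B Q).prodCongr ((Fin.consLinearEquiv B (fun _ => B)).symm ≪≫ₗ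
        LinearEquiv.prodComm B _ _)) ≪≫ₗ (LinearEquiv.prodAssoc B Q (Fin s → B) B).symm
    have : Module.Free B (Q × (Fin s → B)) :=
      Module.Free.of_prod_self_of_rowEquiv hB (e.symm ≪≫ₗ (Module.finBasis B _).equivFun)
    exact ih this

end Cancellation

/-! ### Projective modules are stably free. -/

section Schanuel

variable {B P G F M : Type*} [CommRing B] [AddCommGroup P] [AddCommGroup G] [AddCommGroup F]
  [AddCommGroup M] [Module B P] [Module B G] [Module B F] [Module B M]

/-- The fibre product of a map `q` with kernel `P` and a map which lifts along `q` is a direct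
sum. -/
noncomputable def prodEquivFiberProduct {i : P →ₗ[B] G} {q : G →ₗ[B] M}
    (hi : Function.Injective i) (hq : Function.Exact i q) {r : F →ₗ[B] M} (α : F →ₗ[B] G)
    (hα : q ∘ₗ α = r) :
    (P × F) ≃ₗ[B] LinearMap.eqLocus (q ∘ₗ LinearMap.fst B G F) (r ∘ₗ LinearMap.snd B G F) :=
  LinearEquiv.ofBijective
    (((i ∘ₗ LinearMap.fst B P F + α ∘ₗ LinearMap.snd B P F).prod
      (LinearMap.snd B P F)).codRestrict _ fun x => by
        have h1 : q (i x.1) = 0 := hq.apply_apply_eq_zero _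
        have h2 : q (α x.2) = r x.2 := congr($hα x.2)
        simp [h1, h2]) (by
    constructor
    · rw [← LinearMap.ker_eq_bot, LinearMap.ker_eq_bot']
      rintro ⟨x, y⟩ h
      have h' := congrArg Subtype.val h
      have h1 : i x + α y = 0 := congrArg Prod.fst h'
      obtain rfl : y = 0 := congrArg Prod.snd h'
      rw [map_zero, add_zero] at h1
      rw [(map_eq_zero_iff i hi).1 h1]; rfl
    · rintro ⟨⟨x, y⟩, hxy⟩
      have hxy' : q x = r y := hxy
      obtain ⟨p, hp⟩ := (hq (x - α y)).1 (by
        rw [map_sub, hxy', ← hα, LinearMap.comp_apply, sub_self])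
      refine ⟨(p, y), Subtype.ext ?_⟩
      simp [hp])

/-- **Schanuel's lemma**. -/
theorem nonempty_prod_equiv_prod {F' : Type*} [AddCommGroup F'] [Module B F']
    [Module.Projective B G] [Module.Projective B F]
    {i : P →ₗ[B] G} {q : G →ₗ[B] M} (hi : Function.Injective i) (hiq : Function.Exact i q)
    (hq : Function.Surjective q) {d : F' →ₗ[B] F} {r : F →ₗ[B] M} (hd : Function.Injective d)
    (hdr : Function.Exact d r) (hr : Function.Surjective r) :
    Nonempty ((P × F) ≃ₗ[B] (F' × G)) := by
  obtain ⟨α, hα⟩ := Module.projective_lifting_property q r hq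
  obtain ⟨β, hβ⟩ := Module.projective_lifting_property r q hr
  have e₁ := prodEquivFiberProduct hi hiq α hα
  have e₂ := prodEquivFiberProduct hd hdr β hβ
  refine ⟨e₁ ≪≫ₗ ?_ ≪≫ₗ e₂.symm⟩
  refine LinearEquiv.ofSubmodules (LinearEquiv.prodComm B G F) _ _ ?_
  ext ⟨x, y⟩
  simp only [Submodule.mem_map, LinearMap.mem_eqLocus]
  constructor
  · rintro ⟨⟨a, b⟩, h, h'⟩
    obtain ⟨rfl, rfl⟩ := Prod.mk.inj h'
    exact h.symm
  · intro h
    exact ⟨(y, x), h.symm, rfl⟩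

end Schanuel

/-- A finitely generated torsion-free module over a domain is sandwiched between two free modules
of the same rank. -/
theorem Module.exists_embedding_of_isTorsionFree (B : Type*) {P : Type*} [CommRing B] [IsDomain B]
    [AddCommGroup P] [Module B P] [Module.Finite B P] [Module.IsTorsionFree B P] :
    ∃ (r : ℕ) (i : P →ₗ[B] (Fin r → B)) (e : (Fin r → B) →ₗ[B] P) (g : B), g ≠ 0 ∧
      (∀ y, i (e y) = g • y) ∧ (∀ p, e (i p) = g • p) := by
  obtain ⟨r, hr⟩ : ∃ r, r = Module.finrank B P := ⟨_, rfl⟩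
  obtain ⟨b, hb⟩ := exists_linearIndependent_of_le_finrank (R := B) (M := P) hr.le
  let e : (Fin r → B) →ₗ[B] P := Fintype.linearCombination B b
  have he : Function.Injective e := hb.fintypeLinearCombination_injective
  -- The submodule spanned by `b` has the full rank of `P`; the quotient has rank zero and, being
  -- finitely generated, is killed by a single nonzero `g`.
  have htors : Module.IsTorsion B (P ⧸ LinearMap.range e) := by
    rw [← Module.finrank_eq_zero_iff_isTorsion]
    have h1 := Submodule.finrank_quotient_add_finrank (LinearMap.range e)
    have h2 := LinearMap.finrank_range_of_inj he
    rw [h2, Module.finrank_fin_fun] at h1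
    omega
  obtain ⟨g, hg, hg'⟩ := Submodule.annihilator_top_inter_nonZeroDivisors htors
  have hmem : ∀ p, g • p ∈ LinearMap.range e := by
    intro p
    have := Submodule.mem_annihilator.1 hg (Submodule.Quotient.mk p) trivial
    rwa [← Submodule.Quotient.mk_smul, Submodule.Quotient.mk_eq_zero] at this
  let i : P →ₗ[B] (Fin r → B) :=
    (LinearEquiv.ofInjective e he).symm.toLinearMap ∘ₗ
      (LinearMap.lsmul B P g).codRestrict (LinearMap.range e) hmem
  have hei : ∀ p, e (i p) = g • p := by
    intro p
    have := (LinearEquiv.ofInjective e he).apply_symm_apply ⟨g • p, hmem p⟩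
    exact congrArg Subtype.val this
  exact ⟨r, i, e, g, nonZeroDivisors.ne_zero hg', fun y => he (by rw [hei, map_smul]), hei⟩

section Cokernel

variable {A B C P M : Type*} [CommRing A] [CommRing B] [Algebra A B]
  [AddCommGroup C] [Module A C] [AddCommGroup P] [Module B P]
  [AddCommGroup M] [Module B M] [Module A M] [IsScalarTower A B M]

/-- Let `0 → P → B ^ r → M → 0` be exact with `P` projective and `f M = 0`. If `B / f` is a
finitely generated free `A`-module then `M` is finitely generated and projective over `A`. -/
theorem Module.projective_of_exact_of_smul_eq_zero [Module.Finite A C] [Module.Free A C]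
    [Module.Finite B P] [Module.Projective B P] {f : B} {π : B →ₗ[A] C}
    (hπ : Function.Surjective π) (hker : ∀ x, π x = 0 ↔ ∃ y, x = f * y) (hf : IsRegular f) {r : ℕ}
    {i : P →ₗ[B] (Fin r → B)} {e : (Fin r → B) →ₗ[B] P} (hie : ∀ y, i (e y) = f • y)
    (hei : ∀ p, e (i p) = f • p) {q : (Fin r → B) →ₗ[B] M} (hiq : Function.Exact i q)
    (hq : Function.Surjective q) :
    Module.Finite A M ∧ Module.Projective A M := by
  obtain ⟨σ, hσ⟩ := π.exists_rightInverse_of_surjective (LinearMap.range_eq_top.2 hπ)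
  have hσ' : ∀ c, π (σ c) = c := fun c => congr($hσ c)
  -- `δ x = (x - σ (π x)) / f` is the quotient of a division by `f` with remainder in the image of
  -- `σ`. It is `A`-linear and a left inverse of multiplication by `f`.
  choose δ hδ using fun x => (hker (x - σ (π x))).1 (by rw [map_sub, hσ', sub_self])
  have hδmul : ∀ x, δ (f * x) = x := by
    intro x
    have h1 := hδ (f * x)
    rw [(hker _).2 ⟨x, rfl⟩, map_zero, sub_zero] at h1
    exact (hf.left h1).symm
  let δ' : B →ₗ[A] B :=
    { toFun := δ
      map_add' := fun x y => hf.left (by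
        simp only [mul_add, ← hδ, map_add]; ring)
      map_smul' := fun a x => hf.left (by
        simp only [RingHom.id_apply, mul_smul_comm, ← hδ, map_smul, smul_sub]) }
  let Δ : (Fin r → B) →ₗ[A] (Fin r → B) := δ'.compLeft (Fin r)
  have hΔ : ∀ y, Δ (f • y) = y := fun y => funext fun j => hδmul (y j)
  have hqf : ∀ y, q (f • y) = 0 := fun y => by rw [← hie]; exact hiq.apply_apply_eq_zero _
  have hσπ : ∀ {n : ℕ} (y : Fin n → B), σ.compLeft (Fin n) (π.compLeft (Fin n) y) =
      y - f • fun j => δ (y j) := by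
    intro n y
    ext j
    simp [← hδ]
  constructor
  · refine Module.Finite.of_surjective (q.restrictScalars A ∘ₗ σ.compLeft (Fin r)) fun m => ?_
    obtain ⟨y, rfl⟩ := hq m
    refine ⟨π.compLeft (Fin r) y, ?_⟩
    rw [LinearMap.comp_apply, hσπ, LinearMap.restrictScalars_apply, map_sub, hqf, sub_zero]
  · obtain ⟨n, b, hb⟩ := Module.Finite.exists_fin' B P
    obtain ⟨a, hba⟩ := b.exists_rightInverse_of_surjective (LinearMap.range_eq_top.2 hb)
    have hba' : ∀ p, b (a p) = p := fun p => congr($hba p)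
    -- `M` is exhibited as a retract of `C ^ n` over `A`. The map `e` sends `i P` into `f P`, so
    -- `m₁` factors through `M`; in the other direction, `m₂` undoes the factor `f` coming from `i ∘
    -- e` by means of `Δ`.
    let m₁ : (Fin r → B) →ₗ[A] (Fin n → C) :=
      π.compLeft (Fin n) ∘ₗ (a ∘ₗ e).restrictScalars A
    have hm₁ : LinearMap.ker (q.restrictScalars A) ≤ LinearMap.ker m₁ := by
      intro y hy
      obtain ⟨p, rfl⟩ := (hiq y).1 hy
      ext j
      simp only [m₁, LinearMap.comp_apply, LinearMap.restrictScalars_apply, hei, map_smul,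
        LinearMap.compLeft_apply, Function.comp]
      exact (hker _).2 ⟨_, rfl⟩
    let m₂ : (Fin n → C) →ₗ[A] M :=
      q.restrictScalars A ∘ₗ Δ ∘ₗ (i ∘ₗ b).restrictScalars A ∘ₗ σ.compLeft (Fin n)
    have hm : ∀ y, m₂ (m₁ y) = q y := by
      intro y
      simp only [m₂, m₁, LinearMap.comp_apply, hσπ]
      simp only [LinearMap.restrictScalars_apply, LinearMap.comp_apply, map_sub, map_smul, hba',
        hie, hΔ]
      rw [sub_eq_self]
      exact hiq.apply_apply_eq_zero _
    obtain ⟨s, hs⟩ : ∃ s : M →ₗ[A] (Fin n → C), ∀ y, s (q y) = m₁ y := by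
      let E := (q.restrictScalars A).quotKerEquivOfSurjective hq
      refine ⟨(LinearMap.ker (q.restrictScalars A)).liftQ m₁ hm₁ ∘ₗ E.symm.toLinearMap, fun y => ?_⟩
      have : E.symm (q y) = Submodule.Quotient.mk y := by
        rw [LinearEquiv.symm_apply_eq]; rfl
      rw [LinearMap.comp_apply, LinearEquiv.coe_coe, this, Submodule.liftQ_apply]
    refine Module.Projective.of_split s m₂ (LinearMap.ext fun x => ?_)
    obtain ⟨y, rfl⟩ := hq x
    rw [LinearMap.comp_apply, hs, hm, LinearMap.id_apply]

end Cokernel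

/-- A module which is free of rank `s` over `A` and killed by a Weierstrass polynomial is the
cokernel of the characteristic matrix `t - T`, where `T` is the matrix of multiplication by `t`. -/
theorem exists_exact_of_basis {A B M : Type*} [CommRing A] [CommRing B] [IsDomain B] [Algebra A B]
    [AddCommGroup M] [Module B M] [Module A M] [IsScalarTower A B M] {ι : A[X] →+* B}
    (hι : ∀ a, ι (C a) = algebraMap A B a) {w : A[X]} (hw : ι w ≠ 0)
    (hdiv : ∀ b, ∃ p, ι w ∣ b - ι p) (hwM : ∀ m : M, ι w • m = 0) {s : ℕ} (b : Module.Basis (Fin s) A M) :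
    ∃ (D : (Fin s → B) →ₗ[B] (Fin s → B)) (ev : (Fin s → B) →ₗ[B] M), Function.Injective D ∧
      Function.Exact D ev ∧ Function.Surjective ev := by
  classical
  set t : B := ι X with ht
  let φ := algebraMap A B
  let T : Matrix (Fin s) (Fin s) A := Matrix.of fun i j => b.repr (t • b j) i
  let D : Matrix (Fin s) (Fin s) B := t • 1 - T.map φ
  let ev : (Fin s → B) →ₗ[B] M := Fintype.linearCombination B b
  have hev : ∀ y, ev y = ∑ j, y j • b j := fun y => rfl
  have hevc : ∀ c : Fin s → A, ev (φ ∘ c) = ∑ j, c j • b j := by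
    intro c; rw [hev]; simp [φ, algebraMap_smul]
  have hT : ∀ j, ∑ i, T i j • b i = t • b j := fun j => b.sum_repr _
  have hDev : ev ∘ₗ D.mulVecLin = 0 := by
    refine LinearMap.pi_ext' fun j => LinearMap.ext_ring ?_
    simp only [LinearMap.comp_apply, LinearMap.zero_apply, LinearMap.single_apply,
      Matrix.mulVecLin_apply, mulVec_single_one]
    have : D.col j = t • Pi.single j 1 - φ ∘ (fun i => T i j) := by
      ext i
      simp [D, Matrix.one_apply, Pi.single_apply]
    rw [this, map_sub, hevc, hT, map_smul, hev]
    simp [Pi.single_apply]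
  -- modulo the image of `D` every vector is constant
  have hX : ∀ c : Fin s → A, ∃ c' : Fin s → A, ∃ z, t • (φ ∘ c) = φ ∘ c' + D *ᵥ z := by
    intro c
    refine ⟨T *ᵥ c, φ ∘ c, ?_⟩
    ext j
    simp only [D, sub_mulVec, smul_mulVec, one_mulVec]
    have := RingHom.map_mulVec φ T c j
    simp [this]
  have hpoly : ∀ (p : A[X]) (c : Fin s → A),
      ∃ c' : Fin s → A, ∃ z, ι p • (φ ∘ c) = φ ∘ c' + D *ᵥ z := by
    intro p
    induction p using Polynomial.induction_on' with
    | add p q hp hq =>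
      intro c
      obtain ⟨c₁, z₁, h₁⟩ := hp c
      obtain ⟨c₂, z₂, h₂⟩ := hq c
      refine ⟨c₁ + c₂, z₁ + z₂, ?_⟩
      rw [map_add, add_smul, h₁, h₂, mulVec_add]
      ext j; simp; ring
    | monomial n a =>
      induction n with
      | zero =>
        intro c
        refine ⟨a • c, 0, ?_⟩
        rw [monomial_zero_left, hι]
        ext j; simp [φ]
      | succ n ih =>
        intro c
        obtain ⟨c₁, z₁, h₁⟩ := ih c
        obtain ⟨c₂, z₂, h₂⟩ := hX c₁
        refine ⟨c₂, z₂ + t • z₁, ?_⟩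
        rw [← monomial_mul_X, map_mul, mul_comm, mul_smul, h₁, smul_add, ← ht, h₂, mulVec_add,
          mulVec_smul, add_assoc]
  have hconst : ∀ c : Fin s → A, ev (φ ∘ c) = 0 → c = 0 := by
    intro c hc
    rw [hevc] at hc
    funext j
    exact Fintype.linearIndependent_iff.1 b.linearIndependent c hc j
  have hevD : ∀ z, ev (D *ᵥ z) = 0 := fun z => congr($hDev z)
  -- Modulo the image of `D`, the vector `w eⱼ` is a constant vector which `ev` kills, because `w`
  -- kills `M`; so that constant is zero. The outcome is `D Z = w`, which forces `det D ≠ 0` and the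
  -- injectivity of `D`.
  have hsingle : ∀ j, ∃ z, D *ᵥ z = ι w • (φ ∘ Pi.single j 1) := by
    intro j
    obtain ⟨c, z, h⟩ := hpoly w (Pi.single j 1)
    have h0 := congrArg ev h
    rw [map_smul, hwM, map_add, hevD, add_zero] at h0
    refine ⟨z, ?_⟩
    rw [h, hconst c h0.symm]
    ext k; simp
  have hφsingle : ∀ j, φ ∘ (Pi.single j 1 : Fin s → A) = Pi.single j 1 := by
    intro j
    ext k
    by_cases hk : k = j
    · subst hk; simp
    · simp [hk]
  choose Z hZ using hsingle
  have hDZ : D * (Matrix.of Z)ᵀ = ι w • 1 := by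
    ext i j
    have := congrFun (hZ j) i
    rw [hφsingle] at this
    simpa [Matrix.mul_apply, Matrix.mulVec, dotProduct, Matrix.one_apply, Pi.single_apply] using
      this
  have hdet : D.det ≠ 0 := by
    intro h0
    have := congrArg Matrix.det hDZ
    rw [det_mul, h0, zero_mul, det_smul, det_one, mul_one] at this
    exact pow_ne_zero _ hw this.symm
  have hall : ∀ y, ∃ c : Fin s → A, ∃ z, y = φ ∘ c + D *ᵥ z := by
    intro y
    choose p hp using fun j => hdiv (y j)
    choose r hr using hp
    choose c z hcz using fun j => hpoly (p j) (Pi.single j 1)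
    refine ⟨∑ j, c j, ∑ j, z j + (Matrix.of Z)ᵀ *ᵥ r, ?_⟩
    have h1 : y = ∑ j, ι (p j) • (φ ∘ (Pi.single j 1 : Fin s → A)) + ι w • r := by
      ext k
      simp only [hφsingle, Pi.add_apply, Finset.sum_apply, Pi.smul_apply, Pi.single_apply,
        smul_eq_mul, mul_ite, mul_one, mul_zero, Finset.sum_ite_eq, Finset.mem_univ, if_true]
      linear_combination hr k
    rw [mulVec_add, mulVec_mulVec, hDZ, smul_mulVec, one_mulVec, ← add_assoc, h1]
    congr 1
    simp only [hcz, Finset.sum_add_distrib]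
    congr 1
    · ext k; simp
    · exact (map_sum D.mulVecLin z Finset.univ).symm
  refine ⟨D.mulVecLin, ev, ?_, ?_, ?_⟩
  · rw [← LinearMap.ker_eq_bot, LinearMap.ker_eq_bot']
    exact fun y hy => Matrix.eq_zero_of_mulVec_eq_zero hdet hy
  · intro y
    constructor
    · intro hy
      obtain ⟨c, z, rfl⟩ := hall y
      rw [map_add, hevD, add_zero] at hy
      refine ⟨z, ?_⟩
      rw [hconst c hy, Matrix.mulVecLin_apply]
      ext k; simp
    · rintro ⟨z, rfl⟩
      exact hevD z
  · intro m
    refine ⟨φ ∘ b.repr m, ?_⟩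
    rw [hevc, b.sum_repr]

namespace WeierstrassOver

/-- Projective modules over `B` are stably free if those over `A` are free. -/
theorem exists_free_prod {A B : Type u} [CommRing A] [CommRing B] [IsDomain B]
    (hAB : WeierstrassOver A B) (hA : ProjectiveFree A) (P : Type u) [AddCommGroup P] [Module B P]
    [Module.Finite B P] [Module.Projective B P] :
    ∃ s, Module.Free B (P × (Fin s → B)) := by
  obtain ⟨r, i, e, g, hg, hie, hei⟩ := Module.exists_embedding_of_isTorsionFree B (P := P)
  obtain ⟨ι, w, hw, ⟨c, hc⟩, hdiv, hinj⟩ := hAB g hg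
  have hw0 : ι w ≠ 0 := by
    rw [← hc]; exact (mul_ne_zero_iff_right c.ne_zero).2 hg
  let : Algebra A B := (ι.comp C).toAlgebra
  have halg : ∀ a, ι (C a) = algebraMap A B a := fun a => rfl
  let M := (Fin r → B) ⧸ LinearMap.range i
  let q : (Fin r → B) →ₗ[B] M := (LinearMap.range i).mkQ
  have hq : Function.Surjective q := Submodule.mkQ_surjective _
  have hiq : Function.Exact i q := LinearMap.exact_map_mkQ_range i
  -- Rescaling by the unit `c` replaces `g` by its associate `ι w` in both composites.
  let e' : (Fin r → B) →ₗ[B] P := (c : B) • e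
  have hie' : ∀ y, i (e' y) = ι w • y := fun y => by
    rw [LinearMap.smul_apply, map_smul, hie, smul_smul, mul_comm, hc]
  have hei' : ∀ p, e' (i p) = ι w • p := fun p => by
    rw [LinearMap.smul_apply, hei, smul_smul, mul_comm, hc]
  have hi : Function.Injective i := by
    rw [← LinearMap.ker_eq_bot, LinearMap.ker_eq_bot']
    intro p hp
    have := hei p
    rw [hp, map_zero] at this
    exact (smul_eq_zero.1 this.symm).resolve_left hg
  have := hw.free_quotient
  have := hw.finite_quotient
  let ιA : A[X] →ₐ[A] B := { ι with commutes' := fun a => rfl }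
  let E : (A[X] ⧸ Ideal.span {w}) ≃ₗ[A] (B ⧸ Ideal.span {ι w}) := by
    let Φ := Ideal.quotientMapₐ (Ideal.span {ι w}) ιA (I := Ideal.span {w}) (by
        rw [Ideal.span_singleton_le_iff_mem, Ideal.mem_comap]
        exact Ideal.mem_span_singleton_self _)
    refine LinearEquiv.ofBijective Φ.toLinearMap ⟨?_, ?_⟩
    · rw [← LinearMap.ker_eq_bot, LinearMap.ker_eq_bot']
      intro x hx
      obtain ⟨p, rfl⟩ := Ideal.Quotient.mk_surjective x
      have hx' : Ideal.Quotient.mk (Ideal.span {ι w}) (ι p) = 0 := hx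
      rw [Ideal.Quotient.eq_zero_iff_mem, Ideal.mem_span_singleton] at hx' ⊢
      exact hinj p hx'
    · intro y
      obtain ⟨b, rfl⟩ := Ideal.Quotient.mk_surjective y
      obtain ⟨p, hp⟩ := hdiv b
      refine ⟨Ideal.Quotient.mk _ p, ?_⟩
      change Ideal.Quotient.mk (Ideal.span {ι w}) (ι p) = _
      rw [eq_comm, Ideal.Quotient.eq, Ideal.mem_span_singleton]
      exact hp
  have := Module.Finite.equiv E
  have := Module.Free.of_equiv E
  obtain ⟨hfin, hproj⟩ := Module.projective_of_exact_of_smul_eq_zero (A := A)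
    (π := (Ideal.Quotient.mkₐ A (Ideal.span {ι w})).toLinearMap) Ideal.Quotient.mk_surjective
    (fun x => by
      change Ideal.Quotient.mk (Ideal.span {ι w}) x = 0 ↔ _
      rw [Ideal.Quotient.eq_zero_iff_mem, Ideal.mem_span_singleton]; rfl)
    (IsRegular.of_ne_zero hw0) hie' hei' hiq hq
  have : Nontrivial A := (algebraMap A B).domain_nontrivial
  have hfree := hA M
  let b := Module.finBasis A M
  obtain ⟨D, ev, hD, hDev, hev⟩ := exists_exact_of_basis halg hw0 hdiv (fun m : M => by
    obtain ⟨y, rfl⟩ := hq m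
    rw [← map_smul, ← hie']
    exact hiq.apply_apply_eq_zero _) b
  obtain ⟨φ⟩ := nonempty_prod_equiv_prod hi hiq hq hD hDev hev
  exact ⟨_, Module.Free.of_equiv φ.symm⟩

theorem projectiveFree {A B : Type u} [CommRing A] [IsDomain A] [CommRing B] [IsDomain B]
    (hAB : WeierstrassOver A B) (hA : ProjectiveFree A) : ProjectiveFree B := by
  intro P _ _ _ _
  obtain ⟨s, hs⟩ := hAB.exists_free_prod hA P
  exact Module.Free.of_prod_pi_of_rowEquiv (fun n v hv => hAB.rowEquiv_single hA hv) s hs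

end WeierstrassOver

/-- The statement `ProjectiveFree` for modules in any universe. -/
theorem ProjectiveFree.free {A : Type*} [CommRing A] (hA : ProjectiveFree A) (M : Type*)
    [AddCommGroup M] [Module A M] [Module.Finite A M] [Module.Projective A M] :
    Module.Free A M := by
  have : Small.{u_1} M := Module.Finite.small A M
  let e : Shrink.{u_1} M ≃ₗ[A] M := Shrink.linearEquiv A M
  have := Module.Finite.equiv e.symm
  have := Module.Projective.of_equiv e.symm
  have := hA (Shrink.{u_1} M)
  exact Module.Free.of_equiv e

end Algebra

/-! ### Gauss norms and contractions on power series. -/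

section Analysis

open Filter Topology

namespace MvPowerSeries

section Norm

variable {R : Type*} [NormedCommRing R] {n : ℕ}

/-- The value of the monomial `t ^ I` at the radii `ρ`. -/
def radiusPow (ρ : Fin n → ℝ) (I : Fin n →₀ ℕ) : ℝ := ∏ i, ρ i ^ I i

theorem radiusPow_add (ρ : Fin n → ℝ) (I J : Fin n →₀ ℕ) :
    radiusPow ρ (I + J) = radiusPow ρ I * radiusPow ρ J := by
  simp [radiusPow, pow_add, Finset.prod_mul_distrib]

@[simp]
theorem radiusPow_zero (ρ : Fin n → ℝ) : radiusPow ρ 0 = 1 := by simp [radiusPow]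

theorem radiusPow_single (ρ : Fin n → ℝ) (i : Fin n) (k : ℕ) :
    radiusPow ρ (Finsupp.single i k) = ρ i ^ k := by
  rw [radiusPow, Finset.prod_eq_single i]
  · simp
  · intro j _ hj; simp [hj.symm]
  · simp

theorem radiusPow_const (x : ℝ) (I : Fin n →₀ ℕ) :
    radiusPow (fun _ => x) I = x ^ I.degree := by
  rw [radiusPow, Finset.prod_pow_eq_pow_sum, Finsupp.degree_eq_sum]

theorem radiusPow_pos {ρ : Fin n → ℝ} (hρ : ∀ i, 0 < ρ i) (I : Fin n →₀ ℕ) :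
    0 < radiusPow ρ I :=
  Finset.prod_pos fun i _ => pow_pos (hρ i) _

theorem radiusPow_mono {ρ τ : Fin n → ℝ} (hρ : ∀ i, 0 ≤ ρ i) (h : ∀ i, ρ i ≤ τ i)
    (I : Fin n →₀ ℕ) : radiusPow ρ I ≤ radiusPow τ I :=
  Finset.prod_le_prod (fun i _ => pow_nonneg (hρ i) _) fun i _ =>
    pow_le_pow_left₀ (hρ i) (h i) _

/-- The Gauss norm of `f` with respect to the radii `ρ` is at most `c`. -/
def GaussLE (ρ : Fin n → ℝ) (c : ℝ) (f : MvPowerSeries (Fin n) R) : Prop :=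
  ∀ I, ‖coeff I f‖ * radiusPow ρ I ≤ c

namespace GaussLE

variable {ρ : Fin n → ℝ} {a b c : ℝ} {f g : MvPowerSeries (Fin n) R}

theorem nonneg (h : GaussLE ρ c f) : 0 ≤ c :=
  le_trans (by simp) (h 0)

theorem mono (h : GaussLE ρ a f) (hab : a ≤ b) : GaussLE ρ b f := fun I => (h I).trans hab

theorem mono_radius {τ : Fin n → ℝ} (h : GaussLE τ c f) (h0 : ∀ i, 0 ≤ ρ i)
    (hρ : ∀ i, ρ i ≤ τ i) : GaussLE ρ c f := fun I =>
  (mul_le_mul_of_nonneg_left (radiusPow_mono h0 hρ I) (norm_nonneg _)).trans (h I)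

theorem zero (hc : 0 ≤ c) : GaussLE ρ c (0 : MvPowerSeries (Fin n) R) := fun I => by simpa using hc

theorem neg (h : GaussLE ρ c f) : GaussLE ρ c (-f) := fun I => by simpa using h I

theorem one [NormOneClass R] : GaussLE ρ 1 (1 : MvPowerSeries (Fin n) R) := fun I => by
  classical
  rw [coeff_one]
  split_ifs with h
  · simp [h]
  · simp

theorem X_pow [NormOneClass R] (hρ : ∀ i, 0 < ρ i) (i : Fin n) (d : ℕ) :
    GaussLE ρ (ρ i ^ d) (X i ^ d : MvPowerSeries (Fin n) R) := fun I => by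
  classical
  rw [coeff_X_pow]
  split_ifs with h
  · simp [h, radiusPow_single]
  · simpa using pow_nonneg (hρ i).le d

theorem eq_zero (hρ : ∀ i, 0 < ρ i) (h : GaussLE ρ 0 f) : f = 0 := by
  ext I
  have h1 := h I
  have h2 := radiusPow_pos hρ I
  have h3 : ‖coeff I f‖ ≤ 0 := by
    by_contra! h4
    exact absurd h1 (not_le.2 (mul_pos h4 h2))
  simpa using norm_le_zero_iff.1 h3

theorem eq_zero_of_forall_pow (hρ : ∀ i, 0 < ρ i) {l : ℝ} (hl0 : 0 ≤ l) (hl : l < 1)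
    (h : ∀ k : ℕ, GaussLE ρ (l ^ k * c) f) : f = 0 := by
  refine eq_zero hρ fun I => ?_
  refine ge_of_tendsto' (f := fun k : ℕ => l ^ k * c) (x := atTop) ?_ fun k => h k I
  simpa using (tendsto_pow_atTop_nhds_zero_of_lt_one hl0 hl).mul_const c

theorem eq_zero_of_eq_map (hρ : ∀ i, 0 < ρ i)
    {L : MvPowerSeries (Fin n) R → MvPowerSeries (Fin n) R} {l : ℝ} (hl0 : 0 ≤ l) (hl : l < 1)
    (hL : ∀ {a f}, GaussLE ρ a f → GaussLE ρ (l * a) (L f)) (hf : GaussLE ρ c f) (h : f = L f) :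
    f = 0 := by
  refine eq_zero_of_forall_pow hρ hl0 hl (c := c) fun k => ?_
  induction k with
  | zero => simpa using hf
  | succ k ih => rw [pow_succ', mul_assoc, h]; exact hL ih

variable [IsUltrametricDist R]

theorem add (hf : GaussLE ρ c f) (hg : GaussLE ρ c g) (hρ : ∀ i, 0 < ρ i) :
    GaussLE ρ c (f + g) := fun I => by
  have hp := radiusPow_pos hρ I
  rw [map_add]
  refine (mul_le_mul_of_nonneg_right (IsUltrametricDist.norm_add_le_max _ _) hp.le).trans ?_
  rw [max_mul_of_nonneg _ _ hp.le]
  exact max_le (hf I) (hg I)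

theorem sub (hf : GaussLE ρ c f) (hg : GaussLE ρ c g) (hρ : ∀ i, 0 < ρ i) :
    GaussLE ρ c (f - g) := by
  rw [sub_eq_add_neg]; exact hf.add hg.neg hρ

theorem mul (hf : GaussLE ρ a f) (hg : GaussLE ρ b g) (hρ : ∀ i, 0 < ρ i) :
    GaussLE ρ (a * b) (f * g) := fun I => by
  classical
  have hp := radiusPow_pos hρ I
  rw [coeff_mul, ← le_div_iff₀ hp]
  refine IsUltrametricDist.norm_sum_le_of_forall_le_of_nonneg
    (div_nonneg (mul_nonneg hf.nonneg hg.nonneg) hp.le) fun x hx => ?_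
  rw [le_div_iff₀ hp]
  obtain rfl := Finset.HasAntidiagonal.mem_antidiagonal.1 hx
  rw [radiusPow_add]
  calc _ ≤ ‖coeff x.1 f‖ * ‖coeff x.2 g‖ * (radiusPow ρ x.1 * radiusPow ρ x.2) :=
        mul_le_mul_of_nonneg_right (norm_mul_le _ _)
          (mul_nonneg (radiusPow_pos hρ _).le (radiusPow_pos hρ _).le)
    _ = (‖coeff x.1 f‖ * radiusPow ρ x.1) * (‖coeff x.2 g‖ * radiusPow ρ x.2) := by ring
    _ ≤ a * b := mul_le_mul (hf _) (hg _)
        (mul_nonneg (norm_nonneg _) (radiusPow_pos hρ _).le) hf.nonneg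

/-- **Banach's fixed point theorem** for affine maps with contracting linear part. -/
theorem exists_eq_add [CompleteSpace R] (hρ : ∀ i, 0 < ρ i)
    (L : MvPowerSeries (Fin n) R →+ MvPowerSeries (Fin n) R) {l : ℝ} (hl0 : 0 ≤ l) (hl : l < 1)
    (hL : ∀ {a f}, GaussLE ρ a f → GaussLE ρ (l * a) (L f)) {y : MvPowerSeries (Fin n) R}
    (hy : GaussLE ρ c y) : ∃ x, GaussLE ρ c x ∧ x = y + L x := by
  -- The iterates converge coefficientwise, and the Gauss bounds on their differences pass to the
  -- limit. `L` need not be continuous for coefficientwise convergence: the defect of the limit is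
  -- bounded by `l ^ k * c` for every `k`.
  let u : ℕ → MvPowerSeries (Fin n) R := fun k => (fun x => y + L x)^[k] 0
  have hu : ∀ k, u (k + 1) = y + L (u k) := fun k => Function.iterate_succ_apply' _ _ _
  have hstep : ∀ k, GaussLE ρ (l ^ k * c) (u (k + 1) - u k) := by
    intro k
    induction k with
    | zero => simpa [u] using hy
    | succ k ih =>
      have e : u (k + 1 + 1) - u (k + 1) = L (u (k + 1) - u k) := calc
        _ = (y + L (u (k + 1))) - (y + L (u k)) := congrArg₂ (· - ·) (hu (k + 1)) (hu k)
        _ = _ := by rw [map_sub]; abel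
      rw [e, pow_succ', mul_assoc]
      exact hL ih
  have hc := hy.nonneg
  have hdist : ∀ k m, GaussLE ρ (l ^ k * c) (u (k + m) - u k) := by
    intro k m
    induction m with
    | zero => simpa using GaussLE.zero (by positivity)
    | succ m ih =>
      rw [← sub_add_sub_cancel _ (u (k + m)), ← add_assoc]
      refine ((hstep (k + m)).mono ?_).add ih hρ
      exact mul_le_mul_of_nonneg_right (pow_le_pow_of_le_one hl0 hl.le (by omega)) hc
  have hlim : ∀ I, ∃ x, Tendsto (fun k => coeff I (u k)) atTop (𝓝 x) := by
    intro I
    refine cauchySeq_tendsto_of_complete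
      (cauchySeq_of_le_geometric l (c / radiusPow ρ I) hl fun k => ?_)
    rw [dist_comm, dist_eq_norm, ← map_sub, div_mul_eq_mul_div,
      le_div_iff₀ (radiusPow_pos hρ I), mul_comm c]
    exact hstep k I
  choose x hx using hlim
  let x' : MvPowerSeries (Fin n) R := x
  have hx' : ∀ I, coeff I x' = x I := fun I => rfl
  have happrox : ∀ k, GaussLE ρ (l ^ k * c) (x' - u k) := by
    intro k I
    rw [map_sub, hx']
    refine le_of_tendsto' (((((tendsto_add_atTop_iff_nat k).2 (hx I)).sub_const _).norm).mul_const _)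
      fun m => ?_
    rw [← map_sub, add_comm]
    exact hdist k m I
  have hx0 : GaussLE ρ c x' := by simpa [u] using happrox 0
  refine ⟨x', hx0, ?_⟩
  rw [← sub_eq_zero]
  refine eq_zero_of_forall_pow hρ hl0 hl (c := c) fun k => ?_
  have : x' - (y + L x') = (x' - u (k + 1)) - L (x' - u k) := by
    rw [hu, map_sub]; abel
  rw [this]
  have hle : l ^ (k + 1) * c ≤ l ^ k * c :=
    mul_le_mul_of_nonneg_right (pow_le_pow_of_le_one hl0 hl.le (by omega)) hc
  refine ((happrox (k + 1)).mono hle).sub ((hL (happrox k)).mono ?_) hρ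
  rwa [← mul_assoc, ← pow_succ']

/-- The geometric series, as the fixed point of `g ↦ 1 - f g`. -/
theorem exists_mul_eq_one [CompleteSpace R] [NormOneClass R] (hρ : ∀ i, 0 < ρ i) (hc : c < 1)
    (hf : GaussLE ρ c f) : ∃ g, GaussLE ρ 1 g ∧ (1 + f) * g = 1 := by
  obtain ⟨g, hg, h⟩ := exists_eq_add hρ (AddMonoidHom.mulLeft (-f)) hf.nonneg hc
    (fun h => hf.neg.mul h hρ) (y := 1) one
  refine ⟨g, hg, ?_⟩
  rw [AddMonoidHom.coe_mulLeft] at h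
  linear_combination h

end GaussLE

theorem exists_gt_one_forall_le {ι : Type*} [Finite ι] {ρ : ι → ℝ} (hρ : ∀ i, 1 < ρ i) :
    ∃ x, 1 < x ∧ ∀ i, x ≤ ρ i := by
  have : ∀ᶠ x in 𝓝[>] (1 : ℝ), ∀ i, x ≤ ρ i := by
    rw [eventually_all]
    exact fun i => (eventually_le_nhds (hρ i)).filter_mono nhdsWithin_le_nhds
  obtain ⟨x, hx, h⟩ := (eventually_mem_nhdsWithin.and this).exists
  exact ⟨x, hx, h⟩

theorem tendsto_degree_cofinite : Tendsto (fun I : Fin n →₀ ℕ => I.degree) cofinite atTop := by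
  rw [← Nat.cofinite_eq_atTop]
  refine Tendsto.cofinite_of_finite_preimage_singleton fun k => ?_
  exact (Finsupp.finite_of_degree_le k).subset fun I hI => le_of_eq hI

/-- Boundedness at a radius `x > 1` gives convergence to zero at the smaller radius `√x`, which
still exceeds `1`. So overconvergence can be checked by bounds alone. -/
theorem GaussLE.isOverconvergent {ρ : Fin n → ℝ} {c : ℝ} {f : MvPowerSeries (Fin n) R}
    (hρ : ∀ i, 1 < ρ i) (h : GaussLE ρ c f) : IsOverconvergent f := by
  obtain ⟨x, hx, hxρ⟩ := exists_gt_one_forall_le hρ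
  have h0 : 0 < x := one_pos.trans hx
  have hs : 1 < √x := Real.lt_sqrt_of_sq_lt (by simpa)
  have hs0 : 0 < √x := one_pos.trans hs
  refine ⟨fun _ => √x, fun _ => hs, ?_⟩
  have hlim : Tendsto (fun I : Fin n →₀ ℕ => c * (√x)⁻¹ ^ I.degree) cofinite (𝓝 0) := by
    simpa using ((tendsto_pow_atTop_nhds_zero_of_lt_one (inv_nonneg.2 hs0.le)
      (inv_lt_one_of_one_lt₀ hs)).comp tendsto_degree_cofinite).const_mul c
  refine squeeze_zero (fun I => ?_) (fun I => ?_) hlim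
  · exact mul_nonneg (norm_nonneg _) (Finset.prod_nonneg fun i _ => pow_nonneg hs0.le _)
  · have h1 := (h.mono_radius (ρ := fun _ => x) (fun _ => h0.le) hxρ) I
    rw [radiusPow_const] at h1
    have h2 : I.prod (fun _ k => √x ^ k) = √x ^ I.degree := by
      rw [← radiusPow_const, radiusPow, Finsupp.prod_fintype _ _ (by simp)]
    rw [h2, inv_pow, ← div_eq_mul_inv, le_div_iff₀ (pow_pos hs0 _), mul_assoc, ← mul_pow,
      Real.mul_self_sqrt h0.le]
    exact h1

theorem IsOverconvergent.exists_tendsto {f : MvPowerSeries (Fin n) R} (h : IsOverconvergent f) :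
    ∃ x > 1, Tendsto (fun I => ‖coeff I f‖ * x ^ I.degree) cofinite (𝓝 0) := by
  obtain ⟨ρ, hρ, h⟩ := h
  obtain ⟨x, hx, hxρ⟩ := exists_gt_one_forall_le hρ
  have := IsRestricted.mono_radius (ρ' := fun _ => x) (fun _ => (one_pos.trans hx).le) hxρ h
  refine ⟨x, hx, this.congr fun I => ?_⟩
  rw [← radiusPow_const, radiusPow, Finsupp.prod_fintype _ _ (by simp)]

theorem IsOverconvergent.exists_gaussLE {f : MvPowerSeries (Fin n) R} (h : IsOverconvergent f) :
    ∃ x > 1, ∃ c, GaussLE (fun _ => x) c f := by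
  obtain ⟨x, hx, h⟩ := h.exists_tendsto
  obtain ⟨c, hc⟩ := h.bddAbove_range_of_cofinite
  exact ⟨x, hx, c, fun I => by rw [radiusPow_const]; exact hc ⟨I, rfl⟩⟩

end Norm

end MvPowerSeries

/-! ### Weierstrass division and preparation. -/

namespace MvPowerSeries

section Weierstrass

variable {R : Type*} [NormedCommRing R] {n : ℕ}

/-- The series `f` has degree less than `d` in the first variable. -/
def LowDegree (d : ℕ) (f : MvPowerSeries (Fin (n + 1)) R) : Prop :=
  ∀ I, d ≤ I 0 → coeff I f = 0

/-- The quotient in the division by `X₀ ^ d`. -/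
noncomputable def quotXPow (d : ℕ) : MvPowerSeries (Fin (n + 1)) R →+ MvPowerSeries (Fin (n + 1)) R where
  toFun f := fun I => coeff (I + Finsupp.single 0 d) f
  map_zero' := by ext I; exact map_zero (coeff _)
  map_add' f g := by ext I; exact map_add (coeff _) f g

theorem coeff_quotXPow (d : ℕ) (f : MvPowerSeries (Fin (n + 1)) R) (I : Fin (n + 1) →₀ ℕ) :
    coeff I (quotXPow d f) = coeff (I + Finsupp.single 0 d) f := rfl

theorem quotXPow_mul_X_pow (d : ℕ) (f : MvPowerSeries (Fin (n + 1)) R) :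
    quotXPow d (f * X 0 ^ d) = f := by
  ext I
  rw [coeff_quotXPow, X_pow_eq, coeff_add_mul_monomial, mul_one]

theorem quotXPow_eq_zero {d : ℕ} {f : MvPowerSeries (Fin (n + 1)) R} :
    quotXPow d f = 0 ↔ LowDegree d f := by
  constructor
  · intro h I hI
    have := congrArg (coeff (I - Finsupp.single 0 d)) h
    rwa [coeff_quotXPow, tsub_add_cancel_of_le (by simpa using hI), map_zero] at this
  · intro h
    ext I
    rw [coeff_quotXPow, map_zero]
    exact h _ (by simp)

/-- This turns division by `f` into a fixed point equation: `g - q f` has low degree exactly when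
`q` equals the quotient of `g` minus that of `q (f - X₀ ^ d)`, and the last term is contracting in
`q` if `X₀ ^ d` dominates `f`. -/
theorem quotXPow_mul_eq {d : ℕ} (f q : MvPowerSeries (Fin (n + 1)) R) :
    quotXPow d (q * f) = q + quotXPow d (q * (f - X 0 ^ d)) := by
  rw [mul_sub, map_sub, quotXPow_mul_X_pow]; abel

theorem GaussLE.quotXPow {ρ : Fin (n + 1) → ℝ} (hρ : ∀ i, 0 < ρ i) {c : ℝ} {d : ℕ}
    {f : MvPowerSeries (Fin (n + 1)) R} (h : GaussLE ρ (c * ρ 0 ^ d) f) :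
    GaussLE ρ c (quotXPow d f) := fun I => by
  have := h (I + Finsupp.single 0 d)
  rw [radiusPow_add, radiusPow_single, ← mul_assoc] at this
  exact le_of_mul_le_mul_right this (pow_pos (hρ 0) d)

/-- A power series is distinguished of degree `d` if it is dominated by the monomial `X₀ ^ d` on
suitable arbitrarily small closed polydiscs. -/
def IsDistinguished (d : ℕ) (f : MvPowerSeries (Fin (n + 1)) R) : Prop :=
  ∀ x > 1, ∃ (ρ : Fin (n + 1) → ℝ) (l : ℝ), (∀ i, 1 < ρ i) ∧ (∀ i, ρ i ≤ x) ∧ l < 1 ∧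
    GaussLE ρ (l * ρ 0 ^ d) (f - X 0 ^ d)

theorem degree_eq_add_tail (I : Fin (n + 1) →₀ ℕ) : I.degree = I 0 + I.tail.degree := by
  simp [Finsupp.degree_eq_sum, Fin.sum_univ_succ, Finsupp.tail_apply]

/-- The coefficient of `X₀ ^ k`, a power series in the remaining variables. -/
noncomputable def slice (k : ℕ) (f : MvPowerSeries (Fin (n + 1)) R) : MvPowerSeries (Fin n) R :=
  fun I => coeff (Finsupp.cons k I) f

theorem coeff_slice (k : ℕ) (f : MvPowerSeries (Fin (n + 1)) R) (I : Fin n →₀ ℕ) :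
    coeff I (slice k f) = coeff (Finsupp.cons k I) f := rfl

theorem IsOverconvergent.slice {f : MvPowerSeries (Fin (n + 1)) R} (hf : IsOverconvergent f)
    (k : ℕ) : IsOverconvergent (slice k f) := by
  obtain ⟨x, hx, c, hc⟩ := hf.exists_gaussLE
  have hx0 : 0 < x := one_pos.trans hx
  refine GaussLE.isOverconvergent (ρ := fun _ => x) (c := c) (fun _ => hx) fun I => ?_
  refine le_trans ?_ (hc (Finsupp.cons k I))
  refine mul_le_mul_of_nonneg_left ?_ (norm_nonneg _)
  rw [radiusPow_const, radiusPow_const, degree_eq_add_tail]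
  exact pow_le_pow_right₀ hx.le (by simp)

variable [IsUltrametricDist R]

section Division

variable {ρ : Fin (n + 1) → ℝ} {l : ℝ} {d : ℕ} {f : MvPowerSeries (Fin (n + 1)) R}

theorem GaussLE.quotXPow_mul_sub (hρ : ∀ i, 0 < ρ i) (hf : GaussLE ρ (l * ρ 0 ^ d) (f - X 0 ^ d))
    {a : ℝ} {q : MvPowerSeries (Fin (n + 1)) R} (hq : GaussLE ρ a q) :
    GaussLE ρ (l * a) (-MvPowerSeries.quotXPow d (q * (f - X 0 ^ d))) := by
  refine (GaussLE.quotXPow hρ ?_).neg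
  convert hq.mul hf hρ using 1
  ring

theorem GaussLE.exists_lowDegree_sub_mul [CompleteSpace R] (hρ : ∀ i, 0 < ρ i) (hl0 : 0 ≤ l)
    (hl : l < 1) (hf : GaussLE ρ (l * ρ 0 ^ d) (f - X 0 ^ d)) {c : ℝ}
    {g : MvPowerSeries (Fin (n + 1)) R} (hg : GaussLE ρ (c * ρ 0 ^ d) g) :
    ∃ q, GaussLE ρ c q ∧ GaussLE ρ (l * c) (q - MvPowerSeries.quotXPow d g) ∧
      LowDegree d (g - q * f) := by
  let L : MvPowerSeries (Fin (n + 1)) R →+ MvPowerSeries (Fin (n + 1)) R :=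
    -(MvPowerSeries.quotXPow d).comp (AddMonoidHom.mulRight (f - X 0 ^ d))
  have hL : ∀ q, L q = -MvPowerSeries.quotXPow d (q * (f - X 0 ^ d)) := fun _ => rfl
  obtain ⟨q, hq, h⟩ := GaussLE.exists_eq_add hρ L hl0 hl
    (fun h => by rw [hL]; exact GaussLE.quotXPow_mul_sub hρ hf h) (GaussLE.quotXPow hρ hg)
  rw [hL] at h
  refine ⟨q, hq, ?_, ?_⟩
  · rw [sub_eq_iff_eq_add'.2 h]
    exact GaussLE.quotXPow_mul_sub hρ hf hq
  · rw [← quotXPow_eq_zero, map_sub, quotXPow_mul_eq f]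
    linear_combination -h

theorem GaussLE.eq_zero_of_lowDegree_mul (hρ : ∀ i, 0 < ρ i) (hl0 : 0 ≤ l) (hl : l < 1)
    (hf : GaussLE ρ (l * ρ 0 ^ d) (f - X 0 ^ d)) {c : ℝ} {q : MvPowerSeries (Fin (n + 1)) R}
    (hq : GaussLE ρ c q) (h : LowDegree d (q * f)) : q = 0 := by
  refine GaussLE.eq_zero_of_eq_map hρ
    (L := fun q => -MvPowerSeries.quotXPow d (q * (f - X 0 ^ d))) hl0 hl
    (fun h => GaussLE.quotXPow_mul_sub hρ hf h) hq ?_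
  rw [← quotXPow_eq_zero, quotXPow_mul_eq f] at h
  exact eq_neg_of_add_eq_zero_left h

end Division

/-- The inclusion of the polynomials in the first variable with overconvergent coefficients in
the overconvergent power series. -/
noncomputable def polynomialToMvPowerSeries (n : ℕ) (R : Type*) [NormedCommRing R]
    [IsUltrametricDist R] :
    Polynomial (overconvergent n R) →+* MvPowerSeries (Fin (n + 1)) R :=
  ((finSuccEquiv R n).symm : _ →+* _).comp
    (Polynomial.coeToPowerSeries.ringHom.comp
      (Polynomial.mapRingHom (overconvergent n R).subtype))

theorem coeff_polynomialToMvPowerSeries (p : Polynomial (overconvergent n R))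
    (I : Fin (n + 1) →₀ ℕ) : coeff I (polynomialToMvPowerSeries n R p) =
      coeff I.tail (p.coeff (I 0) : MvPowerSeries (Fin n) R) := by
  conv_lhs => rw [← Finsupp.cons_tail I]
  rw [← coeff_coeff_finSuccEquiv]
  simp [polynomialToMvPowerSeries]

theorem polynomialToMvPowerSeries_mem (p : Polynomial (overconvergent n R)) :
    polynomialToMvPowerSeries n R p ∈ overconvergent (n + 1) R := by
  induction p using Polynomial.induction_on' with
  | add p q hp hq => rw [map_add]; exact add_mem hp hq
  | monomial k a =>
    obtain ⟨x, hx, c, hc⟩ := IsOverconvergent.exists_gaussLE a.2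
    have hx0 : 0 < x := one_pos.trans hx
    refine GaussLE.isOverconvergent (ρ := fun _ => x) (c := c * x ^ k) (fun _ => hx) fun I => ?_
    rw [coeff_polynomialToMvPowerSeries, radiusPow_const, Polynomial.coeff_monomial]
    split_ifs with h
    · rw [degree_eq_add_tail, pow_add, ← h, mul_comm (x ^ k), ← mul_assoc, ← radiusPow_const]
      exact mul_le_mul_of_nonneg_right (hc _) (pow_pos hx0 k).le
    · simpa using mul_nonneg hc.nonneg (pow_pos hx0 k).le

/-- The inclusion of the polynomials in the first variable with overconvergent coefficients in
the overconvergent power series. -/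
noncomputable def polynomialToOverconvergent (n : ℕ) (R : Type*) [NormedCommRing R]
    [IsUltrametricDist R] :
    Polynomial (overconvergent n R) →+* overconvergent (n + 1) R :=
  (polynomialToMvPowerSeries n R).codRestrict _ polynomialToMvPowerSeries_mem

theorem coe_polynomialToOverconvergent (p : Polynomial (overconvergent n R)) :
    (polynomialToOverconvergent n R p : MvPowerSeries (Fin (n + 1)) R) =
      polynomialToMvPowerSeries n R p := rfl

theorem polynomialToOverconvergent_injective :
    Function.Injective (polynomialToOverconvergent n R) := by
  rw [injective_iff_map_eq_zero]
  intro p hp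
  ext k I
  have := congrArg (fun f : overconvergent (n + 1) R => coeff (Finsupp.cons k I) f.1) hp
  simpa [coe_polynomialToOverconvergent, coeff_polynomialToMvPowerSeries] using this

theorem polynomialToOverconvergent_X_pow (d : ℕ) :
    (polynomialToOverconvergent n R (Polynomial.X ^ d) : MvPowerSeries (Fin (n + 1)) R) =
      X 0 ^ d := by
  have : (finSuccEquiv R n).symm PowerSeries.X = X 0 :=
    (finSuccEquiv R n).symm_apply_eq.2 finSuccEquiv_X_zero.symm
  simp [coe_polynomialToOverconvergent, polynomialToMvPowerSeries, this]

theorem lowDegree_polynomialToOverconvergent {d : ℕ} {p : Polynomial (overconvergent n R)}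
    (hp : p.degree < d) :
    LowDegree d (polynomialToOverconvergent n R p : MvPowerSeries (Fin (n + 1)) R) := by
  intro I hI
  rw [coe_polynomialToOverconvergent, coeff_polynomialToMvPowerSeries,
    Polynomial.coeff_eq_zero_of_degree_lt (hp.trans_le (by exact_mod_cast hI))]
  simp

theorem LowDegree.exists_polynomial {d : ℕ} {f : overconvergent (n + 1) R}
    (hf : LowDegree d (f : MvPowerSeries (Fin (n + 1)) R)) :
    ∃ p : Polynomial (overconvergent n R), p.degree < d ∧
      polynomialToOverconvergent n R p = f := by
  refine ⟨∑ k ∈ Finset.range d, Polynomial.monomial k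
    (⟨slice k f.1, IsOverconvergent.slice f.2 k⟩ : overconvergent n R), ?_, ?_⟩
  · rw [Polynomial.degree_lt_iff_coeff_zero]
    intro m hm
    rw [Polynomial.finsetSum_coeff]
    refine Finset.sum_eq_zero fun k hk => ?_
    rw [Polynomial.coeff_monomial, if_neg]
    have := Finset.mem_range.1 hk
    omega
  · apply Subtype.ext
    ext I
    rw [coe_polynomialToOverconvergent, coeff_polynomialToMvPowerSeries,
      Polynomial.finsetSum_coeff]
    simp only [Polynomial.coeff_monomial, Finset.sum_ite_eq', Finset.mem_range]
    split_ifs with h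
    · rw [coeff_slice, Finsupp.cons_tail]
    · rw [hf I (not_lt.1 h)]; simp

/-- **Weierstrass preparation and division**: a distinguished overconvergent series is a unit
times a monic polynomial in the first variable, and the polynomials surject onto the quotient. -/
theorem IsDistinguished.exists_monic [CompleteSpace R] [NormOneClass R] {d : ℕ}
    {f : overconvergent (n + 1) R} (hf : IsDistinguished d (f : MvPowerSeries (Fin (n + 1)) R)) :
    ∃ w : Polynomial (overconvergent n R), w.Monic ∧
      Associated f (polynomialToOverconvergent n R w) ∧
      (∀ b, ∃ p, polynomialToOverconvergent n R w ∣ b - polynomialToOverconvergent n R p) ∧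
      (∀ p, polynomialToOverconvergent n R w ∣ polynomialToOverconvergent n R p → w ∣ p) := by
  set ι := polynomialToOverconvergent n R
  have hf' : ∀ x > 1, ∃ (ρ : Fin (n + 1) → ℝ) (l : ℝ), (∀ i, 1 < ρ i) ∧ (∀ i, ρ i ≤ x) ∧
      (∀ i, 0 < ρ i) ∧ 0 ≤ l ∧ l < 1 ∧
      GaussLE ρ (l * ρ 0 ^ d) ((f : MvPowerSeries (Fin (n + 1)) R) - X 0 ^ d) := by
    intro x hx
    obtain ⟨ρ, l, h1, h2, h3, h4⟩ := hf x hx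
    have hp : ∀ i, 0 < ρ i := fun i => one_pos.trans (h1 i)
    exact ⟨ρ, l, h1, h2, hp, nonneg_of_mul_nonneg_left h4.nonneg (pow_pos (hp 0) d), h3, h4⟩
  have hdivf : ∀ b : overconvergent (n + 1) R, ∃ p, f ∣ b - ι p := by
    intro b
    obtain ⟨x, hx, c, hc⟩ := IsOverconvergent.exists_gaussLE b.2
    -- The polydisc on which `b` converges is not known beforehand; this is why a distinguished
    -- series must be dominated on arbitrarily small polydiscs.
    obtain ⟨ρ, l, h1, h2, hp, hl0, hl, h4⟩ := hf' x hx
    obtain ⟨q, hq, -, hr⟩ := h4.exists_lowDegree_sub_mul hp hl0 hl (c := c / ρ 0 ^ d)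
      (g := b) (by
        rw [div_mul_cancel₀ _ (pow_pos (hp 0) d).ne']
        exact hc.mono_radius (fun i => (hp i).le) h2)
    let q' : overconvergent (n + 1) R := ⟨q, hq.isOverconvergent h1⟩
    obtain ⟨p, -, hp⟩ := LowDegree.exists_polynomial (f := b - q' * f) hr
    exact ⟨p, q', by rw [hp]; ring⟩
  have huniq : ∀ (q : overconvergent (n + 1) R) (p : Polynomial (overconvergent n R)),
      p.degree < d → f * q = ι p → p = 0 := by
    intro q p hpd h
    obtain ⟨x, hx, c, hc⟩ := IsOverconvergent.exists_gaussLE q.2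
    obtain ⟨ρ, l, h1, h2, hp, hl0, hl, h4⟩ := hf' x hx
    have hq := h4.eq_zero_of_lowDegree_mul hp hl0 hl
      (hc.mono_radius (fun i => (hp i).le) h2) (by
        have := lowDegree_polynomialToOverconvergent hpd
        rw [show polynomialToOverconvergent n R p = f * q from h.symm] at this
        rwa [mul_comm])
    apply polynomialToOverconvergent_injective
    change ι p = ι 0
    rw [← h, map_zero, show q = 0 from Subtype.ext hq, mul_zero]
  obtain ⟨ρ, l, h1, -, hp, hl0, hl, h4⟩ := hf' 2 one_lt_two
  -- Divide `X₀ ^ d` by `f`. The quotient `q` differs from `1` by a series of norm at most `l < 1`,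
  -- hence is a unit, and `q f = X₀ ^ d - p` is the required monic polynomial.
  obtain ⟨q, hq, hq1, hr⟩ := h4.exists_lowDegree_sub_mul hp hl0 hl (c := 1) (g := X 0 ^ d) (by
    rw [one_mul]; exact GaussLE.X_pow hp 0 d)
  have hquot : MvPowerSeries.quotXPow d (X 0 ^ d : MvPowerSeries (Fin (n + 1)) R) = 1 := by
    simpa using quotXPow_mul_X_pow d (1 : MvPowerSeries (Fin (n + 1)) R)
  rw [hquot, mul_one] at hq1
  obtain ⟨g, hg, hqg⟩ := hq1.exists_mul_eq_one hp hl
  rw [add_sub_cancel] at hqg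
  let q' : overconvergent (n + 1) R := ⟨q, hq.isOverconvergent h1⟩
  let u : (overconvergent (n + 1) R)ˣ := Units.mkOfMulEqOne q' ⟨g, hg.isOverconvergent h1⟩
    (Subtype.ext hqg)
  obtain ⟨p, hpd, hpf⟩ := LowDegree.exists_polynomial (d := d)
    (f := polynomialToOverconvergent n R (Polynomial.X ^ d) - q' * f) (by
      rw [AddSubgroupClass.coe_sub, polynomialToOverconvergent_X_pow]; exact hr)
  have hw : (Polynomial.X ^ d - p).Monic := Polynomial.monic_X_pow_sub hpd
  have hfu : f * u = ι (Polynomial.X ^ d - p) := by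
    rw [map_sub]
    change f * q' = polynomialToOverconvergent n R _ - polynomialToOverconvergent n R _
    rw [hpf]; ring
  have hassoc : Associated f (ι (Polynomial.X ^ d - p)) := ⟨u, hfu⟩
  refine ⟨Polynomial.X ^ d - p, hw, hassoc, fun b => ?_, fun b hb => ?_⟩
  · obtain ⟨a, ha⟩ := hdivf b
    exact ⟨a, hassoc.dvd_iff_dvd_left.1 ha⟩
  · rw [← Polynomial.modByMonic_eq_zero_iff_dvd hw]
    -- The remainder is a multiple of `f` of low degree, so it vanishes by uniqueness of division.
    have hmod : f ∣ ι (b %ₘ (Polynomial.X ^ d - p)) := by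
      rw [hassoc.dvd_iff_dvd_left, Polynomial.modByMonic_eq_sub_mul_div, map_sub ι b, map_mul]
      exact dvd_sub hb (dvd_mul_right _ _)
    obtain ⟨c, hc⟩ := hmod
    refine huniq c _ ?_ hc.symm
    nontriviality (overconvergent n R)
    refine (Polynomial.degree_modByMonic_lt _ hw).trans_le ?_
    refine (Polynomial.degree_sub_le _ _).trans (max_le (Polynomial.degree_X_pow_le _) hpd.le)

end Weierstrass

end MvPowerSeries

/-! ### A coefficient criterion for distinguished series. -/

namespace MvPowerSeries

section Distinguished

variable {R : Type*} [NormedCommRing R] {n : ℕ}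

theorem radiusPow_cons (x y : ℝ) (I : Fin (n + 1) →₀ ℕ) :
    radiusPow (Fin.cons x fun _ => y : Fin (n + 1) → ℝ) I = x ^ I 0 * y ^ I.tail.degree := by
  rw [radiusPow, Fin.prod_univ_succ]
  simp [Finset.prod_pow_eq_pow_sum, Finsupp.degree_eq_sum, Finsupp.tail_apply]

/-- Only finitely many monomials matter; the others stay below `1 / 2`. First take the radius `η` of
`X₀` so near `1` that the strict bounds for `d ≤ I 0` persist. Then, with `η` fixed, take the other
radii `y` so near `1` that a monomial with `I 0 < d` loses to `η ^ d` because `η ^ I 0 < η ^ d`. -/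
theorem IsDistinguished.of_norm_coeff {d : ℕ} {f : MvPowerSeries (Fin (n + 1)) R}
    (hf : IsOverconvergent (f - X 0 ^ d)) (h1 : ∀ I, ‖coeff I (f - X 0 ^ d)‖ ≤ 1)
    (h2 : ∀ I, d ≤ I 0 → ‖coeff I (f - X 0 ^ d)‖ < 1) : IsDistinguished d f := by
  intro x hx
  set h := f - X 0 ^ d
  obtain ⟨x₁, hx₁, hlim⟩ := hf.exists_tendsto
  set t := min x x₁
  have ht : 1 < t := lt_min hx hx₁
  have ht0 : 0 < t := one_pos.trans ht
  have hlim' : Tendsto (fun I => ‖coeff I h‖ * t ^ I.degree) cofinite (𝓝 0) :=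
    squeeze_zero (fun I => mul_nonneg (norm_nonneg _) (pow_pos ht0 _).le) (fun I =>
      mul_le_mul_of_nonneg_left (pow_le_pow_left₀ ht0.le (min_le_right _ _) _) (norm_nonneg _)) hlim
  have hfin : {I | ¬ ‖coeff I h‖ * t ^ I.degree ≤ 1 / 2}.Finite :=
    hlim'.eventually_le_const (by norm_num)
  have hη : ∀ᶠ y in 𝓝[>] (1 : ℝ), ∀ I ∈ hfin.toFinset, d ≤ I 0 →
      ‖coeff I h‖ * y ^ I.degree < y ^ d := by
    rw [eventually_all_finset]
    intro I _
    by_cases hd : d ≤ I 0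
    · have : ∀ᶠ y in 𝓝 (1 : ℝ), ‖coeff I h‖ * y ^ I.degree < y ^ d :=
        ContinuousAt.eventually_lt (by fun_prop) (by fun_prop) (by simpa using h2 I hd)
      filter_upwards [this.filter_mono nhdsWithin_le_nhds] with y hy _ using hy
    · exact Eventually.of_forall fun _ h => absurd h hd
  obtain ⟨η, hη1, hηt, hη⟩ := (eventually_mem_nhdsWithin.and
    (((eventually_le_nhds ht).filter_mono nhdsWithin_le_nhds).and hη)).exists
  have hη1 : 1 < η := hη1
  have hη0 : 0 < η := one_pos.trans hη1
  have hy : ∀ᶠ y in 𝓝[>] (1 : ℝ), ∀ I ∈ hfin.toFinset, I 0 < d →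
      ‖coeff I h‖ * (η ^ I 0 * y ^ I.tail.degree) < η ^ d := by
    rw [eventually_all_finset]
    intro I _
    by_cases hd : I 0 < d
    · have : ∀ᶠ y in 𝓝 (1 : ℝ), ‖coeff I h‖ * (η ^ I 0 * y ^ I.tail.degree) < η ^ d := by
        refine ContinuousAt.eventually_lt (by fun_prop) (by fun_prop) ?_
        rw [one_pow, mul_one]
        calc _ ≤ 1 * η ^ I 0 := mul_le_mul_of_nonneg_right (h1 I) (pow_pos hη0 _).le
          _ < η ^ d := by rw [one_mul]; exact pow_lt_pow_right₀ hη1 hd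
      filter_upwards [this.filter_mono nhdsWithin_le_nhds] with y hy _ using hy
    · exact Eventually.of_forall fun _ h => absurd h hd
  obtain ⟨y, hy1, hyη, hy⟩ := (eventually_mem_nhdsWithin.and
    (((eventually_le_nhds hη1).filter_mono nhdsWithin_le_nhds).and hy)).exists
  have hy1 : 1 < y := hy1
  have hy0 : 0 < y := one_pos.trans hy1
  set ρ : Fin (n + 1) → ℝ := Fin.cons η fun _ => y
  have hρη : ∀ i, ρ i ≤ η := fun i => Fin.cases (by simp [ρ]) (fun i => by simpa [ρ] using hyη) i
  have hρ1 : ∀ i, 1 < ρ i := fun i => Fin.cases (by simpa [ρ]) (fun i => by simpa [ρ]) i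
  have hρ0 : ∀ i, 0 ≤ ρ i := fun i => (one_pos.trans (hρ1 i)).le
  have hlt : ∀ I ∈ hfin.toFinset, ‖coeff I h‖ * radiusPow ρ I < η ^ d := by
    intro I hI
    rcases lt_or_ge (I 0) d with hd | hd
    · rw [radiusPow_cons]; exact hy I hI hd
    · refine lt_of_le_of_lt (mul_le_mul_of_nonneg_left ?_ (norm_nonneg _)) (hη I hI hd)
      rw [← radiusPow_const]
      exact radiusPow_mono hρ0 hρη I
  have hl : ∀ᶠ l in 𝓝[<] (1 : ℝ), ∀ I ∈ hfin.toFinset,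
      ‖coeff I h‖ * radiusPow ρ I ≤ l * η ^ d := by
    rw [eventually_all_finset]
    intro I hI
    have : ∀ᶠ l in 𝓝 (1 : ℝ), ‖coeff I h‖ * radiusPow ρ I < l * η ^ d :=
      ContinuousAt.eventually_lt (by fun_prop) (by fun_prop) (by simpa using hlt I hI)
    filter_upwards [this.filter_mono nhdsWithin_le_nhds] with l hl using hl.le
  obtain ⟨l, hl1, hl2, hl⟩ := (eventually_mem_nhdsWithin.and
    (((eventually_ge_nhds (show (1 / 2 : ℝ) < 1 by norm_num)).filter_mono
      nhdsWithin_le_nhds).and hl)).exists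
  refine ⟨ρ, l, hρ1, fun i => (hρη i).trans (hηt.trans (min_le_left _ _)), hl1, fun I => ?_⟩
  by_cases hI : I ∈ hfin.toFinset
  · exact hl I hI
  · have hI' : ‖coeff I h‖ * t ^ I.degree ≤ 1 / 2 := by simpa using hI
    calc _ ≤ ‖coeff I h‖ * t ^ I.degree := by
          refine mul_le_mul_of_nonneg_left ?_ (norm_nonneg _)
          rw [← radiusPow_const]
          exact radiusPow_mono hρ0 (fun i => (hρη i).trans hηt) I
      _ ≤ 1 / 2 := hI'
      _ ≤ l := hl2
      _ ≤ l * η ^ d := le_mul_of_one_le_right (by linarith) (one_le_pow₀ hη1.le)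

end Distinguished

/-! ### Shears and their effect on monomials. -/

section Shear

variable {R : Type*} [CommRing R] {n : ℕ}

/-- The variables `X₀` and `X_{i + 1} + s X₀ ^ (e i)`. -/
noncomputable def shearVar (e : Fin n → ℕ) (s : R) (i : Fin (n + 1)) :
    MvPowerSeries (Fin (n + 1)) R :=
  Fin.cases (X 0) (fun i => X i.succ + C s * X 0 ^ e i) i

@[simp]
theorem shearVar_zero (e : Fin n → ℕ) (s : R) : shearVar e s 0 = X 0 := rfl

@[simp]
theorem shearVar_succ (e : Fin n → ℕ) (s : R) (i : Fin n) :
    shearVar e s i.succ = X i.succ + C s * X 0 ^ e i := rfl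

theorem hasSubst_shearVar {e : Fin n → ℕ} (he : ∀ i, 0 < e i) (s : R) :
    HasSubst (shearVar e s) := by
  refine hasSubst_of_constantCoeff_zero fun i => ?_
  cases i using Fin.cases with
  | zero => simp
  | succ i => simp [(he i).ne']

/-- The automorphism `X_{i + 1} ↦ X_{i + 1} + s X₀ ^ (e i)` of the ring of power series. -/
noncomputable def shear {e : Fin n → ℕ} (he : ∀ i, 0 < e i) (s : R) :
    MvPowerSeries (Fin (n + 1)) R →ₐ[R] MvPowerSeries (Fin (n + 1)) R :=
  substAlgHom (hasSubst_shearVar he s)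

theorem shear_shear {e : Fin n → ℕ} (he : ∀ i, 0 < e i) {s t : R} (hst : s + t = 0)
    (f : MvPowerSeries (Fin (n + 1)) R) : shear he s (shear he t f) = f := by
  rw [shear, shear, substAlgHom_comp_substAlgHom_apply]
  have : (fun i => substAlgHom (hasSubst_shearVar he s) (shearVar e t i)) = X := by
    funext i
    cases i using Fin.cases with
    | zero => exact substAlgHom_X _ _
    | succ i =>
      have hC : substAlgHom (hasSubst_shearVar he s) (C t : MvPowerSeries (Fin (n + 1)) R) =
          C t := (substAlgHom (hasSubst_shearVar he s)).commutes t
      have hst' : (C s + C t : MvPowerSeries (Fin (n + 1)) R) = 0 := by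
        rw [← map_add, hst, map_zero]
      simp only [shearVar_succ, map_add, map_mul, map_pow, substAlgHom_X, shearVar_zero, hC]
      linear_combination (X 0 ^ e i) * hst'
  rw [substAlgHom_apply]
  refine Eq.trans ?_ (congrFun subst_self f)
  congr 1

theorem coeff_shear {e : Fin n → ℕ} (he : ∀ i, 0 < e i) (s : R)
    (f : MvPowerSeries (Fin (n + 1)) R) (J : Fin (n + 1) →₀ ℕ) :
    coeff J (shear he s f) =
      ∑ᶠ I : Fin (n + 1) →₀ ℕ, coeff I f * coeff J (∏ i, shearVar e s i ^ I i) := by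
  rw [shear, substAlgHom_apply, coeff_subst (hasSubst_shearVar he s)]
  refine finsum_congr fun I => ?_
  rw [Finsupp.prod_fintype _ _ (by simp), smul_eq_mul]

theorem shear_monomial {e : Fin n → ℕ} (he : ∀ i, 0 < e i) (s : R)
    (I : Fin (n + 1) →₀ ℕ) (a : R) :
    shear he s (monomial I a) = C a * ∏ i, shearVar e s i ^ I i := by
  rw [shear, substAlgHom_monomial, Finsupp.prod_fintype _ _ (by simp)]
  rfl

end Shear

section ShearNorm

variable {R : Type*} [NormedCommRing R] [NormOneClass R] [IsUltrametricDist R] {n : ℕ}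

theorem GaussLE.pow {ρ : Fin n → ℝ} (hρ : ∀ i, 0 < ρ i) {c : ℝ} {f : MvPowerSeries (Fin n) R}
    (h : GaussLE ρ c f) (k : ℕ) : GaussLE ρ (c ^ k) (f ^ k) := by
  induction k with
  | zero => simpa using GaussLE.one
  | succ k ih => rw [pow_succ, pow_succ]; exact ih.mul h hρ

theorem GaussLE.prod {ρ : Fin n → ℝ} (hρ : ∀ i, 0 < ρ i) {ι : Type*} {c : ι → ℝ}
    {f : ι → MvPowerSeries (Fin n) R} (s : Finset ι) (h : ∀ i ∈ s, GaussLE ρ (c i) (f i)) :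
    GaussLE ρ (∏ i ∈ s, c i) (∏ i ∈ s, f i) := by
  classical
  induction s using Finset.induction_on with
  | empty => simpa using GaussLE.one
  | insert a s ha ih =>
    rw [Finset.prod_insert ha, Finset.prod_insert ha]
    exact (h a (by simp)).mul (ih fun i hi => h i (by simp [hi])) hρ

theorem GaussLE.shearVar {e : Fin n → ℕ} {s : R} (hs : ‖s‖ ≤ 1) {x y : ℝ} (hx : 0 < x)
    (hxy : x ≤ y) (hy : ∀ i, x ^ e i ≤ y) (i : Fin (n + 1)) :
    GaussLE (fun _ => x) y (shearVar e s i) := by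
  have hp : ∀ _ : Fin (n + 1), 0 < x := fun _ => hx
  cases i using Fin.cases with
  | zero => simpa using (GaussLE.X_pow hp 0 1).mono (by simpa)
  | succ i =>
    rw [shearVar_succ]
    refine GaussLE.add ?_ ?_ hp
    · simpa using (GaussLE.X_pow hp i.succ 1).mono (by simpa)
    · refine GaussLE.mono (a := 1 * x ^ e i) ?_ (by simpa using hy i)
      refine GaussLE.mul (fun I => ?_) (GaussLE.X_pow hp 0 _) hp
      classical
      rw [coeff_C]
      split_ifs with h
      · simpa [h] using hs
      · simp

theorem GaussLE.prod_shearVar {e : Fin n → ℕ} {s : R} (hs : ‖s‖ ≤ 1) {x y : ℝ} (hx : 0 < x)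
    (hxy : x ≤ y) (hy : ∀ i, x ^ e i ≤ y) (I : Fin (n + 1) →₀ ℕ) :
    GaussLE (fun _ => x) (y ^ I.degree) (∏ i, MvPowerSeries.shearVar e s i ^ I i) := by
  rw [← radiusPow_const]
  exact GaussLE.prod (fun _ => hx) _ fun i _ =>
    (GaussLE.shearVar hs hx hxy hy i).pow (fun _ => hx) _

/-- At radius `x` each new variable has norm at most `y`, so the image of a monomial is no larger
than the monomial at radius `y`. -/
theorem GaussLE.shear {e : Fin n → ℕ} (he : ∀ i, 0 < e i) {s : R} (hs : ‖s‖ ≤ 1) {x y : ℝ}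
    (hx : 0 < x) (hxy : x ≤ y) (hy : ∀ i, x ^ e i ≤ y) {c : ℝ}
    {f : MvPowerSeries (Fin (n + 1)) R} (hf : GaussLE (fun _ => y) c f) :
    GaussLE (fun _ => x) c (shear he s f) := fun J => by
  have hpos := radiusPow_pos (fun _ : Fin (n + 1) => hx) J
  rw [coeff_shear, ← le_div_iff₀ hpos]
  refine finsum_induction (fun z => ‖z‖ ≤ c / radiusPow (fun _ => x) J)
    (by simpa using div_nonneg hf.nonneg hpos.le)
    (fun z w hz hw => (IsUltrametricDist.norm_add_le_max z w).trans (max_le hz hw)) fun I => ?_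
  rw [le_div_iff₀ hpos]
  refine le_trans ?_ (hf I)
  rw [radiusPow_const y]
  calc _ ≤ ‖coeff I f‖ * ‖coeff J (∏ i, MvPowerSeries.shearVar e s i ^ I i)‖ *
        radiusPow (fun _ => x) J := mul_le_mul_of_nonneg_right (norm_mul_le _ _) hpos.le
    _ ≤ _ := by
      rw [mul_assoc]
      exact mul_le_mul_of_nonneg_left (GaussLE.prod_shearVar hs hx hxy hy I J) (norm_nonneg _)

theorem IsOverconvergent.shear {e : Fin n → ℕ} (he : ∀ i, 0 < e i) {s : R} (hs : ‖s‖ ≤ 1)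
    {f : MvPowerSeries (Fin (n + 1)) R} (hf : IsOverconvergent f) :
    IsOverconvergent (shear he s f) := by
  obtain ⟨y, hy, c, hc⟩ := hf.exists_gaussLE
  have : ∀ᶠ x in 𝓝[>] (1 : ℝ), ∀ i, x ^ e i ≤ y := by
    rw [eventually_all]
    intro i
    have : ∀ᶠ x in 𝓝 (1 : ℝ), x ^ e i < y :=
      ContinuousAt.eventually_lt (by fun_prop) (by fun_prop) (by simpa using hy)
    filter_upwards [this.filter_mono nhdsWithin_le_nhds] with x hx using hx.le
  obtain ⟨x, hx1, hxy, hx⟩ := (eventually_mem_nhdsWithin.and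
    (((eventually_le_nhds hy).filter_mono nhdsWithin_le_nhds).and this)).exists
  exact (hc.shear he hs (one_pos.trans hx1) hxy hx).isOverconvergent fun _ => hx1

/-- The automorphism `X_{i + 1} ↦ X_{i + 1} + s X₀ ^ (e i)` of the ring of overconvergent power
series, as a ring homomorphism. -/
noncomputable def shearHom {e : Fin n → ℕ} (he : ∀ i, 0 < e i) {s : R} (hs : ‖s‖ ≤ 1) :
    overconvergent (n + 1) R →+* overconvergent (n + 1) R :=
  (shear he s).toRingHom.restrict _ _ fun _ hf => IsOverconvergent.shear he hs hf

theorem coe_shearHom {e : Fin n → ℕ} (he : ∀ i, 0 < e i) {s : R} (hs : ‖s‖ ≤ 1)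
    (f : overconvergent (n + 1) R) :
    (shearHom he hs f : MvPowerSeries (Fin (n + 1)) R) = shear he s f.1 := rfl

theorem shearHom_comp_shearHom {e : Fin n → ℕ} (he : ∀ i, 0 < e i) {s t : R} (hs : ‖s‖ ≤ 1)
    (ht : ‖t‖ ≤ 1) (hst : s + t = 0) : (shearHom he hs).comp (shearHom he ht) = RingHom.id _ := by
  ext1 f
  apply Subtype.ext
  rw [RingHom.comp_apply, coe_shearHom, coe_shearHom, shear_shear he hst, RingHom.id_apply]

/-- The automorphism `X_{i + 1} ↦ X_{i + 1} + X₀ ^ (e i)` of the ring of overconvergent power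
series. -/
noncomputable def shearEquiv (R : Type*) [NormedCommRing R] [NormOneClass R] [IsUltrametricDist R]
    {e : Fin n → ℕ} (he : ∀ i, 0 < e i) :
    overconvergent (n + 1) R ≃+* overconvergent (n + 1) R :=
  RingEquiv.ofRingHom (shearHom he (s := (1 : R)) (by simp)) (shearHom he (s := (-1 : R)) (by simp))
    (shearHom_comp_shearHom he _ _ (by simp)) (shearHom_comp_shearHom he _ _ (by simp))

end ShearNorm

section LeadingMonomial

variable {R : Type*} [CommRing R] {n : ℕ}

/-- The coefficient of `X₀ ^ w` is `1`, and `X₀ ^ w` is the only monomial of degree at least `w`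
in `X₀` that occurs. -/
def HasLeadingXPow (w : ℕ) (f : MvPowerSeries (Fin (n + 1)) R) : Prop :=
  (∀ J, w ≤ J 0 → J ≠ Finsupp.single 0 w → coeff J f = 0) ∧ coeff (Finsupp.single 0 w) f = 1

theorem HasLeadingXPow.one : HasLeadingXPow 0 (1 : MvPowerSeries (Fin (n + 1)) R) := by
  classical
  refine ⟨fun J _ hJ => ?_, by simp⟩
  rw [coeff_one, if_neg (by simpa using hJ)]

theorem HasLeadingXPow.mul {w w' : ℕ} {f g : MvPowerSeries (Fin (n + 1)) R}
    (hf : HasLeadingXPow w f) (hg : HasLeadingXPow w' g) : HasLeadingXPow (w + w') (f * g) := by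
  classical
  have key : ∀ J : Fin (n + 1) →₀ ℕ, w + w' ≤ J 0 → ∀ x ∈ Finset.HasAntidiagonal.antidiagonal J,
      x ≠ (Finsupp.single 0 w, Finsupp.single 0 w') → coeff x.1 f * coeff x.2 g = 0 := by
    rintro J hJ ⟨a, b⟩ hx hne
    obtain rfl := Finset.HasAntidiagonal.mem_antidiagonal.1 hx
    simp only [Finsupp.add_apply] at hJ
    by_cases ha : w ≤ a 0
    · by_cases ha' : a = Finsupp.single 0 w
      · have hb : w' ≤ b 0 := by simpa [ha'] using hJ
        rw [hg.1 b hb fun hb' => hne (by rw [ha', hb']), mul_zero]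
      · rw [hf.1 a ha ha', zero_mul]
    · have hb : w' ≤ b 0 := by omega
      rw [hg.1 b hb fun hb' => by simp [hb'] at hJ; omega, mul_zero]
  constructor
  · intro J hJ hne
    rw [coeff_mul]
    refine Finset.sum_eq_zero fun x hx => key J hJ x hx ?_
    rintro rfl
    apply hne
    rw [← Finset.HasAntidiagonal.mem_antidiagonal.1 hx, Finsupp.single_add]
  · rw [coeff_mul, Finset.sum_eq_single (Finsupp.single 0 w, Finsupp.single 0 w')]
    · simp [hf.2, hg.2]
    · exact key _ (by simp)
    · intro h
      exact absurd (Finset.HasAntidiagonal.mem_antidiagonal.2 (by simp)) h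

theorem HasLeadingXPow.pow {w : ℕ} {f : MvPowerSeries (Fin (n + 1)) R}
    (hf : HasLeadingXPow w f) (k : ℕ) : HasLeadingXPow (w * k) (f ^ k) := by
  induction k with
  | zero => simpa using HasLeadingXPow.one
  | succ k ih => rw [pow_succ, mul_add, mul_one]; exact ih.mul hf

theorem HasLeadingXPow.prod {ι : Type*} {w : ι → ℕ} {f : ι → MvPowerSeries (Fin (n + 1)) R}
    (s : Finset ι) (h : ∀ i ∈ s, HasLeadingXPow (w i) (f i)) :
    HasLeadingXPow (∑ i ∈ s, w i) (∏ i ∈ s, f i) := by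
  classical
  induction s using Finset.induction_on with
  | empty => simpa using HasLeadingXPow.one
  | insert a s ha ih =>
    rw [Finset.prod_insert ha, Finset.sum_insert ha]
    exact (h a (by simp)).mul (ih fun i hi => h i (by simp [hi]))

/-- The sheared monomial has a pure power of `X₀` as its only term of top degree in `X₀`, and the
exponent is the weight of `I`. Positivity of `e` puts `X_{i + 1}` strictly below `X₀ ^ (e i)`. -/
theorem HasLeadingXPow.prod_shearVar {e : Fin n → ℕ} (he : ∀ i, 0 < e i)
    (I : Fin (n + 1) →₀ ℕ) :
    HasLeadingXPow (∑ i, (Fin.cons 1 e : Fin (n + 1) → ℕ) i * I i)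
      (∏ i, shearVar e (1 : R) i ^ I i) := by
  classical
  refine HasLeadingXPow.prod _ fun i _ => HasLeadingXPow.pow ?_ _
  cases i using Fin.cases with
  | zero =>
    refine ⟨fun J _ hJ => ?_, by simp [X_def]⟩
    rw [shearVar_zero, coeff_X, if_neg (by simpa using hJ)]
  | succ i =>
    have h0 : ∀ J : Fin (n + 1) →₀ ℕ, e i ≤ J 0 → J ≠ Finsupp.single i.succ 1 := by
      rintro J hJ rfl
      have := he i
      simp at hJ
      omega
    constructor
    · intro J hJ hne
      rw [Fin.cons_succ] at hJ hne
      rw [shearVar_succ, map_add, coeff_X, if_neg (h0 J hJ), map_one, one_mul, coeff_X_pow,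
        if_neg hne, add_zero]
    · rw [Fin.cons_succ, shearVar_succ, map_add, coeff_X, if_neg (h0 _ (by simp)), map_one,
        one_mul, coeff_X_pow, if_pos rfl, zero_add]

end LeadingMonomial

end MvPowerSeries

/-- Uniqueness of digits in base `b`. -/
theorem eq_of_sum_pow_mul_eq {b : ℕ} : ∀ {n : ℕ} {I J : Fin n → ℕ}, (∀ i, I i < b) →
    (∀ i, J i < b) → ∑ i : Fin n, b ^ (i : ℕ) * I i = ∑ i : Fin n, b ^ (i : ℕ) * J i → I = J
  | 0, I, J, _, _, _ => Subsingleton.elim I J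
  | n + 1, I, J, hI, hJ, h => by
    rw [Fin.sum_univ_succ, Fin.sum_univ_succ] at h
    have key : ∀ I : Fin (n + 1) → ℕ, ∑ i : Fin n, b ^ (i.succ : ℕ) * I i.succ =
        b * ∑ i : Fin n, b ^ (i : ℕ) * I i.succ := by
      intro I
      rw [Finset.mul_sum]
      exact Finset.sum_congr rfl fun i _ => by rw [Fin.val_succ, pow_succ']; ring
    rw [key, key] at h
    simp only [Fin.val_zero, pow_zero, one_mul] at h
    have h0 : I 0 = J 0 := by
      have := congrArg (· % b) h
      simpa [Nat.add_mul_mod_self_left, Nat.mod_eq_of_lt (hI 0), Nat.mod_eq_of_lt (hJ 0)] using this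
    rw [h0, Nat.add_left_cancel_iff] at h
    have hb : 0 < b := (Nat.zero_le _).trans_lt (hI 0)
    have := eq_of_sum_pow_mul_eq (I := fun i => I i.succ) (J := fun i => J i.succ)
      (fun i => hI _) (fun i => hJ _) (Nat.eq_of_mul_eq_mul_left hb h)
    ext i
    cases i using Fin.cases with
    | zero => exact h0
    | succ i => exact congrFun this i

/-- Positive weights, the first of them `1`, that separate finitely many exponents. -/
theorem exists_injOn_weight {n : ℕ} (S : Finset (Fin (n + 1) →₀ ℕ)) :
    ∃ e : Fin n → ℕ, (∀ i, 0 < e i) ∧ Set.InjOn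
      (fun I : Fin (n + 1) →₀ ℕ => ∑ i, (Fin.cons 1 e : Fin (n + 1) → ℕ) i * I i) S := by
  set b := S.sup (fun I => I.degree) + 1
  have hlt : ∀ I ∈ S, ∀ i, I i < b := fun I hI i =>
    Nat.lt_succ_of_le ((Finsupp.le_degree i I).trans (Finset.le_sup (f := fun I => I.degree) hI))
  refine ⟨fun i => b ^ ((i : ℕ) + 1), fun i => by positivity, fun I hI J hJ h => ?_⟩
  have key : (Fin.cons 1 fun i : Fin n => b ^ ((i : ℕ) + 1) : Fin (n + 1) → ℕ) =
      fun i : Fin (n + 1) => b ^ (i : ℕ) := by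
    ext i
    cases i using Fin.cases <;> simp
  simp only [key] at h
  exact DFunLike.coe_injective (eq_of_sum_pow_mul_eq (hlt I hI) (hlt J hJ) h)

/-! ### Weierstrass preparation and the theorem over a field. -/

namespace MvPowerSeries

section Field

variable {K : Type*} [NormedField K] [IsUltrametricDist K] {n : ℕ}

theorem isOverconvergent_C {R : Type*} [NormedCommRing R] (a : R) :
    IsOverconvergent (C a : MvPowerSeries (Fin n) R) :=
  ⟨fun _ => 2, fun _ => one_lt_two, isRestricted_C _ a⟩

theorem isOverconvergent_X_pow {R : Type*} [NormedCommRing R] (i : Fin n) (d : ℕ) :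
    IsOverconvergent (X i ^ d : MvPowerSeries (Fin n) R) :=
  ⟨fun _ => 2, fun _ => one_lt_two, by rw [X_pow_eq]; exact isRestricted_monomial _ _ _⟩

theorem norm_coeff_prod_shearVar_le_one (e : Fin n → ℕ) (I J : Fin (n + 1) →₀ ℕ) :
    ‖coeff J (∏ i, shearVar e (1 : K) i ^ I i)‖ ≤ 1 := by
  have := GaussLE.prod_shearVar (R := K) (e := e) (s := 1) (by simp) one_pos le_rfl (by simp) I J
  simpa [radiusPow_const] using this

/-- Suppose the coefficients of `f` have norm at most `1`, the coefficient at `I₀` is `1` and all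
other coefficients of norm `1` have smaller weight. Then a shear makes `f` distinguished. -/
theorem isDistinguished_shear {e : Fin n → ℕ} (he : ∀ i, 0 < e i)
    {f : MvPowerSeries (Fin (n + 1)) K} (hf : IsOverconvergent f) (h1 : ∀ I, ‖coeff I f‖ ≤ 1)
    {I₀ : Fin (n + 1) →₀ ℕ} (hI₀ : coeff I₀ f = 1) {w : (Fin (n + 1) →₀ ℕ) → ℕ}
    (hw : ∀ I, w I = ∑ i, (Fin.cons 1 e : Fin (n + 1) → ℕ) i * I i)
    (hlt : ∀ I, I ≠ I₀ → ‖coeff I f‖ = 1 → w I < w I₀) :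
    IsDistinguished (w I₀) (shear he 1 f) := by
  classical
  have hlead : ∀ I, HasLeadingXPow (w I) (∏ i, shearVar e (1 : K) i ^ I i) := fun I => by
    rw [hw]; exact HasLeadingXPow.prod_shearVar he I
  set g := f - monomial I₀ 1
  have hg : ∀ I, coeff I g = if I = I₀ then 0 else coeff I f := by
    intro I
    rw [map_sub, coeff_monomial]
    split_ifs with h
    · rw [h, hI₀, sub_self]
    · rw [sub_zero]
  have hfg : shear he (1 : K) f - X 0 ^ w I₀ =
      shear he 1 g + ((∏ i, shearVar e (1 : K) i ^ I₀ i) - X 0 ^ w I₀) := by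
    rw [map_sub, shear_monomial, map_one, one_mul]; ring
  have hg1 : ∀ J, ‖coeff J (shear he (1 : K) g)‖ ≤ 1 := by
    intro J
    rw [coeff_shear]
    refine finsum_induction (fun z : K => ‖z‖ ≤ 1) (by simp)
      (fun z w hz hw => (IsUltrametricDist.norm_add_le_max z w).trans (max_le hz hw)) fun I => ?_
    rw [norm_mul]
    refine mul_le_one₀ ?_ (norm_nonneg _) (norm_coeff_prod_shearVar_le_one e I J)
    rw [hg]
    split_ifs
    · simp
    · exact h1 I
  -- A term of `g` either has coefficient of norm below `1`, or has weight below `w I₀`; in the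
  -- latter case its shear has no monomial of `X₀`-degree `w I₀` or more.
  have hg2 : ∀ J, w I₀ ≤ J 0 → ‖coeff J (shear he (1 : K) g)‖ < 1 := by
    intro J hJ
    rw [coeff_shear]
    refine finsum_induction (fun z : K => ‖z‖ < 1) (by simp)
      (fun z w hz hw => (IsUltrametricDist.norm_add_le_max z w).trans_lt (max_lt hz hw)) fun I => ?_
    rw [hg]
    split_ifs with hI
    · simp
    rcases (h1 I).lt_or_eq with h | h
    · rw [norm_mul]
      exact mul_lt_one_of_nonneg_of_lt_one_left (norm_nonneg _) h
        (norm_coeff_prod_shearVar_le_one e I J)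
    · have hwI := hlt I hI h
      rw [(hlead I).1 J (by omega) (by rintro rfl; simp at hJ; omega)]
      simp
  have hX : ∀ J, coeff J (X 0 ^ w I₀ : MvPowerSeries (Fin (n + 1)) K) =
      if J = Finsupp.single 0 (w I₀) then 1 else 0 := fun J => coeff_X_pow _ _ _
  refine IsDistinguished.of_norm_coeff
    ((overconvergent (n + 1) K).sub_mem (hf.shear he (by simp)) (isOverconvergent_X_pow 0 _))
    (fun J => ?_) fun J hJ => ?_
  · rw [hfg, map_add]
    refine (IsUltrametricDist.norm_add_le_max _ _).trans (max_le (hg1 J) ?_)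
    rw [map_sub, sub_eq_add_neg]
    refine (IsUltrametricDist.norm_add_le_max _ _).trans
      (max_le (norm_coeff_prod_shearVar_le_one e _ J) ?_)
    rw [norm_neg, hX]
    split_ifs <;> simp
  · have h0 : coeff J ((∏ i, shearVar e (1 : K) i ^ I₀ i) - X 0 ^ w I₀) = 0 := by
      rw [map_sub, hX]
      split_ifs with h
      · rw [h, (hlead I₀).2, sub_self]
      · rw [(hlead I₀).1 J hJ h, sub_self]
    rw [hfg, map_add, h0, add_zero]
    exact hg2 J hJ

theorem IsOverconvergent.finite_le_norm {R : Type*} [NormedCommRing R]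
    {f : MvPowerSeries (Fin n) R} (hf : IsOverconvergent f) {c : ℝ} (hc : 0 < c) :
    {I | c ≤ ‖coeff I f‖}.Finite := by
  obtain ⟨x, hx, h⟩ := hf.exists_tendsto
  have : ∀ᶠ I in cofinite, ‖coeff I f‖ * x ^ I.degree < c := h.eventually_lt_const hc
  refine Set.Finite.subset this fun I (hI : c ≤ _) => ?_
  exact not_lt.2 (hI.trans (le_mul_of_one_le_right (norm_nonneg _) (one_le_pow₀ hx.le)))

/-- **Weierstrass preparation** for arbitrary nonzero overconvergent series over a field. -/
theorem weierstrassOver_overconvergent [CompleteSpace K] :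
    WeierstrassOver (overconvergent n K) (overconvergent (n + 1) K) := by
  intro g hg
  obtain ⟨I₁, hI₁⟩ : ∃ I, coeff I g.1 ≠ 0 := by
    by_contra! h
    exact hg (Subtype.ext (MvPowerSeries.ext h))
  -- the largest norm of a coefficient is attained
  obtain ⟨I₂, hI₂⟩ : ∃ I₂, coeff I₂ g.1 ≠ 0 ∧ ∀ I, ‖coeff I g.1‖ ≤ ‖coeff I₂ g.1‖ := by
    have hfin := IsOverconvergent.finite_le_norm g.2 (norm_pos_iff.2 hI₁)
    obtain ⟨I₂, hm, hI₂⟩ := hfin.toFinset.exists_max_image (fun I => ‖coeff I g.1‖)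
      ⟨I₁, by simp⟩
    have hm' : ‖coeff I₁ g.1‖ ≤ ‖coeff I₂ g.1‖ := by simpa using hm
    refine ⟨I₂, norm_pos_iff.1 ((norm_pos_iff.2 hI₁).trans_le hm'), fun I => ?_⟩
    by_cases hI : I ∈ hfin.toFinset
    · exact hI₂ I hI
    · exact (not_le.1 (by simpa using hI)).le.trans hm'
  have hfin := IsOverconvergent.finite_le_norm g.2 (norm_pos_iff.2 hI₂.1)
  obtain ⟨e, he, hinj⟩ := exists_injOn_weight hfin.toFinset
  set w : (Fin (n + 1) →₀ ℕ) → ℕ := fun I => ∑ i, (Fin.cons 1 e : Fin (n + 1) → ℕ) i * I i with hw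
  -- Among the coefficients of maximal norm, take the one of greatest weight. It is unique because
  -- the weights are injective on this finite set, and `u` scales it to `1`.
  obtain ⟨I₀, hm, hI₀⟩ := hfin.toFinset.exists_max_image w ⟨I₂, by simp⟩
  have hm' : ‖coeff I₀ g.1‖ = ‖coeff I₂ g.1‖ := le_antisymm (hI₂.2 _) (by simpa using hm)
  have hc : coeff I₀ g.1 ≠ 0 := norm_pos_iff.1 (hm' ▸ norm_pos_iff.2 hI₂.1)
  set c := coeff I₀ g.1
  let u : (overconvergent (n + 1) K)ˣ := Units.mkOfMulEqOne
    ⟨C c⁻¹, isOverconvergent_C _⟩ ⟨C c, isOverconvergent_C _⟩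
    (Subtype.ext (by
      change C c⁻¹ * C c = (1 : MvPowerSeries (Fin (n + 1)) K)
      rw [← map_mul, inv_mul_cancel₀ hc, map_one]))
  have hcoeff : ∀ I, coeff I (g * (u : overconvergent (n + 1) K)).1 = c⁻¹ * coeff I g.1 := by
    intro I
    rw [mul_comm g]
    exact coeff_C_mul I g.1 c⁻¹
  have hnorm : ∀ I, ‖coeff I (g * (u : overconvergent (n + 1) K)).1‖ =
      ‖coeff I g.1‖ / ‖coeff I₂ g.1‖ := by
    intro I
    rw [hcoeff, norm_mul, norm_inv, hm', mul_comm, div_eq_mul_inv]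
  have hpos := norm_pos_iff.2 hI₂.1
  have hdist : IsDistinguished (w I₀) (shear he 1 (g * (u : overconvergent (n + 1) K)).1) := by
    refine isDistinguished_shear he (g * (u : overconvergent (n + 1) K)).2 (fun I => ?_) ?_
      (fun I => rfl) fun I hI h => ?_
    · rw [hnorm]; exact (div_le_one hpos).2 (hI₂.2 I)
    · rw [hcoeff, inv_mul_cancel₀ hc]
    · rw [hnorm, div_eq_one_iff_eq hpos.ne'] at h
      have hmem : I ∈ hfin.toFinset := by simpa using h.ge
      exact (hI₀ I hmem).lt_of_ne fun h' => hI (hinj hmem hm h')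
  set σ := shearEquiv K he
  obtain ⟨p, hp, hassoc, hdiv, hdvd⟩ := IsDistinguished.exists_monic
    (f := σ (g * (u : overconvergent (n + 1) K))) hdist
  -- The preparation holds for the sheared series, so the embedding of `A[X]` is the standard one
  -- followed by the inverse shear.
  refine ⟨(σ.symm : _ →+* _).comp (polynomialToOverconvergent n K), p, hp, ?_, fun b => ?_,
    fun q hq => ?_⟩
  · have h1 := hassoc.map (σ.symm : overconvergent (n + 1) K →+* overconvergent (n + 1) K)
    have h2 : Associated g (g * (u : overconvergent (n + 1) K)) := ⟨u, rfl⟩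
    refine h2.trans ?_
    simpa using h1
  · obtain ⟨q, hq⟩ := hdiv (σ b)
    refine ⟨q, ?_⟩
    have := map_dvd σ.symm hq
    simpa using this
  · refine hdvd q ?_
    have := map_dvd σ hq
    simpa using this

end Field

instance {K : Type*} [NormedField K] [IsUltrametricDist K] {n : ℕ} :
    IsDomain (overconvergent n K) :=
  have : NoZeroDivisors (overconvergent n K) :=
    Subtype.val_injective.noZeroDivisors _ rfl fun _ _ => rfl
  NoZeroDivisors.to_isDomain _

theorem isLocalRing_overconvergent_zero (R : Type*) [NormedCommRing R] [IsUltrametricDist R]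
    [IsLocalRing R] : IsLocalRing (overconvergent 0 R) := by
  let φ : R →+* overconvergent 0 R := C.codRestrict _ fun a => isOverconvergent_C a
  have : Nontrivial (overconvergent 0 R) := inferInstance
  refine IsLocalRing.of_surjective' φ fun f => ⟨coeff 0 f.1, Subtype.ext ?_⟩
  ext I
  classical
  rw [Subsingleton.elim I 0]
  exact coeff_zero_C _

/-- The absolute value may be trivial here. In that case the ring is a polynomial ring over `K` and
this is the Quillen–Suslin theorem, which the integral case needs for the residue field. -/
theorem projectiveFree_overconvergent {K : Type*} [NormedField K] [IsUltrametricDist K]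
    [CompleteSpace K] (n : ℕ) : ProjectiveFree (overconvergent n K) := by
  induction n with
  | zero =>
    intro M _ _ _ _
    have := isLocalRing_overconvergent_zero K
    exact Module.free_of_flat_of_isLocalRing
  | succ n ih => exact weierstrassOver_overconvergent.projectiveFree ih

end MvPowerSeries

/-! ### Discrete valuation rings: reduction to the residue field. -/

theorem ProjectiveFree.free_of_ringEquiv {A B : Type*} [CommRing A] [CommRing B]
    (hA : ProjectiveFree A) (e : A ≃+* B) (M : Type*) [AddCommGroup M] [Module B M]
    [Module.Finite B M] [Module.Projective B M] : Module.Free B M := by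
  let : Module A M := Module.compHom M (e : A →+* B)
  let := RingHomInvPair.of_ringEquiv e
  let := RingHomInvPair.symm (↑e : A →+* B) (↑e.symm : B →+* A)
  let l : M ≃ₛₗ[(e : A →+* B)] M :=
    { AddEquiv.refl M with map_smul' := fun _ _ => rfl }
  have : Module.Finite A M :=
    Module.Finite.of_surjective l.symm.toLinearMap l.symm.surjective
  have : Module.Projective A M := Module.Projective.of_equiv l.symm
  have := hA.free M
  exact Module.Free.of_equiv l

/-- Freeness of projective modules lifts along a quotient by a nonzero element of the Jacobson
radical of a domain. -/
theorem ProjectiveFree.free_of_ker_eq_span {A B : Type*} [CommRing A] [CommRing B] [IsDomain B]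
    (hA : ProjectiveFree A) {φ : B →+* A} (hφ : Function.Surjective φ) {x : B} (hx : x ≠ 0)
    (hker : RingHom.ker φ = Ideal.span {x}) (hjac : x ∈ (⊥ : Ideal B).jacobson)
    (M : Type*) [AddCommGroup M] [Module B M] [Module.Finite B M] [Module.Projective B M] :
    Module.Free B M := by
  have := Module.finitePresentation_of_projective B M
  refine (Module.free_quotSMulTop_iff_free B M hjac (IsSMulRegular.of_ne_zero hx)).1 ?_
  let e : A ≃+* B ⧸ Ideal.span {x} :=
    ((Ideal.quotEquivOfEq hker.symm).trans (RingHom.quotientKerEquivOfSurjective hφ)).symm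
  let l := ((QuotSMulTop.equivQuotTensor x M).extendScalarsOfSurjective
    (S := B ⧸ Ideal.span {x}) Ideal.Quotient.mk_surjective).symm
  have : Module.Finite (B ⧸ Ideal.span {x}) (QuotSMulTop x M) := Module.Finite.equiv l
  have : Module.Projective (B ⧸ Ideal.span {x}) (QuotSMulTop x M) :=
    Module.Projective.of_equiv l
  exact hA.free_of_ringEquiv e _

/-- The trivial absolute value turns a field into a normed field. -/
noncomputable abbrev trivialNormedField (k : Type*) [Field k] : NormedField k := by
  classical exact (AbsoluteValue.trivial : AbsoluteValue k ℝ).toNormedField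

theorem norm_trivialNormedField {k : Type*} [Field k] {x : k} (hx : x ≠ 0) :
    (trivialNormedField k).norm x = 1 := by
  classical exact AbsoluteValue.trivial_apply hx

theorem isUltrametricDist_of_norm_eq_one {k : Type*} [NormedField k]
    (h : ∀ x : k, x ≠ 0 → ‖x‖ = 1) : IsUltrametricDist k := by
  refine IsUltrametricDist.isUltrametricDist_of_forall_norm_add_le_max_norm fun x y => ?_
  by_cases hx : x = 0
  · simp [hx]
  by_cases hxy : x + y = 0
  · simp [hxy]
  · rw [h x hx, h _ hxy]
    exact le_max_left _ _

theorem completeSpace_of_norm_eq_one {k : Type*} [NormedField k]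
    (h : ∀ x : k, x ≠ 0 → ‖x‖ = 1) : CompleteSpace k := by
  refine Metric.complete_of_cauchySeq_tendsto fun u hu => ?_
  obtain ⟨N, hN⟩ := Metric.cauchySeq_iff'.1 hu 1 one_pos
  refine ⟨u N, tendsto_const_nhds.congr' ?_⟩
  filter_upwards [eventually_ge_atTop N] with m hm
  by_contra hne
  have h1 := hN m hm
  rw [dist_eq_norm, h _ (sub_ne_zero.2 (Ne.symm hne))] at h1
  exact lt_irrefl _ h1

theorem norm_le_one_of_norm_lt_one_iff {O : Type*} [NormedCommRing O] [IsLocalRing O]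
    [NormMulClass O] (h : ∀ x : O, ‖x‖ < 1 ↔ x ∈ IsLocalRing.maximalIdeal O) (x : O) : ‖x‖ ≤ 1 := by
  by_cases hx : x ∈ IsLocalRing.maximalIdeal O
  · exact ((h x).2 hx).le
  · obtain ⟨y, hy⟩ := (IsLocalRing.notMem_maximalIdeal.1 hx).exists_right_inv
    have hy' : ¬ ‖y‖ < 1 := fun hlt =>
      (IsLocalRing.mem_maximalIdeal y).1 ((h y).1 hlt) (IsUnit.of_mul_eq_one x (by rwa [mul_comm]))
    have : NormOneClass O := NormMulClass.toNormOneClass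
    have h1 : ‖x‖ * ‖y‖ = 1 := by rw [← norm_mul, hy, norm_one]
    nlinarith [norm_nonneg x, norm_nonneg y]

namespace MvPowerSeries

theorem isOverconvergent_of_finite_support {R : Type*} [NormedCommRing R] {n : ℕ}
    {f : MvPowerSeries (Fin n) R} (hf : {I | coeff I f ≠ 0}.Finite) : IsOverconvergent f := by
  refine ⟨fun _ => 2, fun _ => one_lt_two, ?_⟩
  unfold IsRestricted
  refine tendsto_const_nhds.congr' ?_
  filter_upwards [hf.compl_mem_cofinite] with I hI
  have hI : coeff I f = 0 := by simpa using hI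
  simp [hI]

section Reduction

variable {R k : Type*} [NormedCommRing R] [NormedField k] {n : ℕ} {φ : R →+* k}

/-- All but finitely many coefficients have norm below `1`, so the reduction is a polynomial. -/
theorem IsOverconvergent.map_of_norm_lt_one (h0 : ∀ a, ‖a‖ < 1 → φ a = 0)
    {f : MvPowerSeries (Fin n) R} (hf : IsOverconvergent f) : IsOverconvergent (map φ f) := by
  refine isOverconvergent_of_finite_support ((hf.finite_le_norm one_pos).subset fun I hI => ?_)
  by_contra h
  exact hI (by rw [coeff_map]; exact h0 _ (not_le.1 h))

variable [IsUltrametricDist R] [IsUltrametricDist k]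

/-- The coefficientwise reduction of overconvergent power series along a ring homomorphism that
kills the elements of norm less than one. -/
noncomputable def overconvergentMap (n : ℕ) (h0 : ∀ a, ‖a‖ < 1 → φ a = 0) :
    overconvergent n R →+* overconvergent n k :=
  (map φ).restrict (overconvergent n R) (overconvergent n k) fun _ hf =>
    IsOverconvergent.map_of_norm_lt_one h0 hf

theorem coeff_overconvergentMap (h0 : ∀ a, ‖a‖ < 1 → φ a = 0) (f : overconvergent n R)
    (I : Fin n →₀ ℕ) : coeff I (overconvergentMap n h0 f).1 = φ (coeff I f.1) :=
  coeff_map φ I f.1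

theorem overconvergentMap_surjective (h0 : ∀ a, ‖a‖ < 1 → φ a = 0)
    (h1 : ∀ x : k, x ≠ 0 → ‖x‖ = 1) (hφ : Function.Surjective φ) :
    Function.Surjective (overconvergentMap n h0) := by
  classical
  intro g
  -- Lifting `0` to `0` keeps the support finite, since an overconvergent series over a trivially
  -- normed field is a polynomial.
  let s : k → R := fun x => if x = 0 then 0 else Function.surjInv hφ x
  have hs : ∀ x, φ (s x) = x := by
    intro x
    by_cases hx : x = 0
    · simp [s, hx]
    · simp [s, hx, Function.surjInv_eq hφ]
  let f : MvPowerSeries (Fin n) R := fun I => s (coeff I g.1)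
  have hf : ∀ I, coeff I f = s (coeff I g.1) := fun _ => rfl
  refine ⟨⟨f, isOverconvergent_of_finite_support ?_⟩, Subtype.ext (MvPowerSeries.ext fun I => ?_)⟩
  · refine (IsOverconvergent.finite_le_norm g.2 one_pos).subset fun I hI => ?_
    refine (h1 _ fun h => hI ?_).ge
    rw [hf, h]
    simp [s]
  · rw [coeff_overconvergentMap]
    exact hs _

end Reduction

section Jacobson

variable {R : Type*} [NormedCommRing R] [NormOneClass R] [IsUltrametricDist R] [CompleteSpace R]
  {n : ℕ}

/-- The criterion for distinguished series in degree `0` says that `f` has Gauss norm below `1` on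
some polydisc of radii above `1`; the geometric series converges there. -/
theorem isUnit_one_add_overconvergent {f : overconvergent (n + 1) R}
    (hf : ∀ I, ‖coeff I f.1‖ < 1) : IsUnit (1 + f) := by
  have hd : IsDistinguished 0 (1 + f.1) := by
    refine IsDistinguished.of_norm_coeff ?_ ?_ ?_
    · rw [pow_zero, add_sub_cancel_left]
      exact f.2
    · intro I; simpa using (hf I).le
    · intro I _; simpa using hf I
  obtain ⟨ρ, l, hρ, -, hl, h⟩ := hd 2 one_lt_two
  obtain ⟨g, hg, hfg⟩ := GaussLE.exists_mul_eq_one (f := f.1) (fun i => one_pos.trans (hρ i)) hl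
    (by simpa using h)
  exact IsUnit.of_mul_eq_one ⟨g, hg.isOverconvergent hρ⟩ (Subtype.ext hfg)

end Jacobson

section DVR

variable {O : Type*} [NormedCommRing O] [IsDomain O] [IsUltrametricDist O]

instance [NormMulClass O] {n : ℕ} : IsDomain (overconvergent n O) :=
  have : NoZeroDivisors (overconvergent n O) :=
    Subtype.val_injective.noZeroDivisors _ rfl fun _ _ => rfl
  NoZeroDivisors.to_isDomain _

variable [IsDiscreteValuationRing O] [NormMulClass O]

/-- Reduction modulo the uniformizer `p` has kernel generated by `p`, and `p` lies in the Jacobson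
radical because `1 + p f` is always a unit. -/
theorem free_overconvergent_of_isDiscreteValuationRing [CompleteSpace O]
    (h : ∀ x : O, ‖x‖ < 1 ↔ x ∈ IsLocalRing.maximalIdeal O) (n : ℕ) (M : Type*)
    [AddCommGroup M] [Module (overconvergent n O) M] [Module.Finite (overconvergent n O) M]
    [Module.Projective (overconvergent n O) M] : Module.Free (overconvergent n O) M := by
  cases n with
  | zero =>
    have := isLocalRing_overconvergent_zero O
    exact Module.free_of_flat_of_isLocalRing
  | succ n =>
    have : NormOneClass O := NormMulClass.toNormOneClass
    let k := IsLocalRing.ResidueField O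
    let : NormedField k := trivialNormedField k
    have h1 : ∀ x : k, x ≠ 0 → ‖x‖ = 1 := fun _ hx => norm_trivialNormedField hx
    have := isUltrametricDist_of_norm_eq_one h1
    have := completeSpace_of_norm_eq_one h1
    have h0 : ∀ a : O, ‖a‖ < 1 → IsLocalRing.residue O a = 0 := fun a ha =>
      (IsLocalRing.residue_eq_zero_iff a).2 ((h a).1 ha)
    obtain ⟨p, hp⟩ := IsDiscreteValuationRing.exists_irreducible O
    have hpm : IsLocalRing.maximalIdeal O = Ideal.span {p} := hp.maximalIdeal_eq
    have hp1 : ‖p‖ < 1 := (h p).2 (hpm ▸ Ideal.mem_span_singleton_self p)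
    let x : overconvergent (n + 1) O := ⟨C p, isOverconvergent_C p⟩
    have hcoeff : ∀ (f : overconvergent (n + 1) O) I,
        coeff I (x * f).1 = p * coeff I f.1 := fun f I => coeff_C_mul I f.1 p
    refine (projectiveFree_overconvergent (K := k) (n + 1)).free_of_ker_eq_span
      (φ := overconvergentMap (n + 1) h0) (x := x)
      (overconvergentMap_surjective h0 h1 IsLocalRing.residue_surjective) ?_ ?_ ?_ M
    · intro hx
      have := congrArg (fun f : overconvergent (n + 1) O => coeff 0 f.1) hx
      exact hp.ne_zero (by simpa [x] using this)
    · ext f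
      rw [RingHom.mem_ker, Ideal.mem_span_singleton]
      constructor
      · intro hf
        have hdvd : ∀ I, ∃ a, coeff I f.1 = p * a := by
          intro I
          have hI : IsLocalRing.residue O (coeff I f.1) = 0 := by
            rw [← coeff_overconvergentMap h0, hf]
            exact map_zero _
          rw [IsLocalRing.residue_eq_zero_iff, hpm, Ideal.mem_span_singleton] at hI
          exact hI
        choose a ha using hdvd
        have hpos : 0 < ‖p‖ := norm_pos_iff.2 hp.ne_zero
        -- Dividing every coefficient by `p` scales all norms by the same constant `‖p‖⁻¹`, so the
        -- quotient converges on the same polydisc.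
        let g : MvPowerSeries (Fin (n + 1)) O := a
        have hg : IsOverconvergent g := by
          obtain ⟨ρ, hρ, hf⟩ := f.2
          refine ⟨ρ, hρ, ?_⟩
          unfold IsRestricted at hf ⊢
          have := hf.const_mul ‖p‖⁻¹
          rw [mul_zero] at this
          refine this.congr fun I => ?_
          have hI : ‖coeff I f.1‖ = ‖p‖ * ‖coeff I g‖ := by rw [ha, norm_mul]; rfl
          rw [hI]
          field_simp
        refine ⟨⟨g, hg⟩, Subtype.ext (MvPowerSeries.ext fun I => ?_)⟩
        rw [hcoeff]
        exact ha I
      · rintro ⟨g, rfl⟩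
        refine Subtype.ext (MvPowerSeries.ext fun I => ?_)
        rw [coeff_overconvergentMap, hcoeff, map_mul, h0 p hp1, zero_mul]
        exact (map_zero _).symm
    · refine Ideal.mem_jacobson_bot.2 fun f => ?_
      rw [add_comm (x * f)]
      refine isUnit_one_add_overconvergent fun I => ?_
      rw [hcoeff, norm_mul]
      exact mul_lt_one_of_nonneg_of_lt_one_left (norm_nonneg _) hp1
        (norm_le_one_of_norm_lt_one_iff h _)

end DVR

end MvPowerSeries

end Analysis

/-- Every finite projective module over `K⟨t_1, …, t_n⟩^†` (`K` a field complete for a nontrivial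
nonarchimedean absolute value) or over `O⟨t_1, …, t_n⟩^†` (`O` a complete discrete valuation ring)
is free. On `O` the norm is a nonarchimedean absolute value that defines the valuation: the
elements of norm `< 1` are those of the maximal ideal. -/
theorem theorem6p8 :
    (∀ (K : Type*) [NontriviallyNormedField K] [IsUltrametricDist K] [CompleteSpace K]
      (n : ℕ) (M : Type*) [AddCommGroup M] [Module (MvPowerSeries.overconvergent n K) M]
      [Module.Finite (MvPowerSeries.overconvergent n K) M]
      [Module.Projective (MvPowerSeries.overconvergent n K) M],
      Module.Free (MvPowerSeries.overconvergent n K) M) ∧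
    (∀ (O : Type*) [NormedCommRing O] [IsDomain O] [IsDiscreteValuationRing O]
      [NormMulClass O] [IsUltrametricDist O] [CompleteSpace O]
      (_ : ∀ x : O, ‖x‖ < 1 ↔ x ∈ IsLocalRing.maximalIdeal O)
      (n : ℕ) (M : Type*) [AddCommGroup M] [Module (MvPowerSeries.overconvergent n O) M]
      [Module.Finite (MvPowerSeries.overconvergent n O) M]
      [Module.Projective (MvPowerSeries.overconvergent n O) M],
      Module.Free (MvPowerSeries.overconvergent n O) M) := by
  exact ⟨fun K _ _ _ n M _ _ _ _ => (MvPowerSeries.projectiveFree_overconvergent n).free M,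
    fun O _ _ _ _ _ _ h n M _ _ _ _ =>
      MvPowerSeries.free_overconvergent_of_isDiscreteValuationRing h n M⟩
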